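/- Let $N\ge 1$ be an integer. For a holomorphic map $f:\mathbb C\to\mathbb CP^N$, written locally as $f=[f_0:f_1:\dots:f_N]$ with holomorphic functions $f_i$ without common zeros, define the spherical derivative $|df|(z)\ge 0$ by $$|df|^2(z)=\frac1{4\pi}\,\Delta\log\bigl(|f_0|^2+\dots+|f_N|^2\bigr)(z),\qquad \Delta=\frac{\partial^2}{\partial x^2}+\frac{\partial^2}{\partial y^2},$$ (which does not depend on the choice of the $f_i$), and put $\|df\|_{L^\infty(D)}=\sup_{z\in D}|df|(z)$ for $D\subset\mathbb C$. The map $f$ is a Brody curve if it is holomorphic and $|df|(z)\le 1$ for all $z\in\mathbb C$. A Brody curve $f$ is non-degenerate if there are $\delta>0$ and $R>0$ such that $\|df\|_{L^\infty(D_R(a))}\ge\delta$ for every $a\in\mathbb C$, where $D_R(a)=\{z:|z-a|\le R\}$. The energy density of a Brody curve $f$ is $$\rho(f)=\lim_{R\to\infty}\frac1{\pi R^2}\Bigl(\sup_{a\in\mathbb C}\int_{|z-a|<R}|df|^2\,dx\,dy\Bigr).$$ **Theorem.** Let $f:\mathbb C\to\mathbb CP^N$ be a holomorphic map with $\|df\|_{L^\infty(\mathbb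 C)}<1$. Then for every $\varepsilon>0$ there exists a non-degenerate Brody curve $g:\mathbb C\to\mathbb CP^N$ with $\|dg\|_{L^\infty(\mathbb C)}<1$ and $\rho(g)\ge\rho(f)-\varepsilon$. (In particular, the limits defining $\rho(f)$ and $\rho(g)$ exist.) -/

import Mathlib

open Filter Topology MeasureTheory
open scoped ENNReal

namespace BrodyCurves

/-- Complex projective space `ℂP^N`, the lines of `ℂ^{N+1}`. -/
abbrev CP (N : ℕ) : Type := Projectivization ℂ (EuclideanSpace ℂ (Fin (N + 1)))

/-- `F = (F₀, …, F_N)` is a holomorphic system of homogeneous coordinates for `f` near `z`: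
it is holomorphic near `z`, has no zero there, and `f = [F₀ : … : F_N]` near `z`. -/
def IsLocalLift {N : ℕ} (f : ℂ → CP N) (z : ℂ)
    (F : ℂ → EuclideanSpace ℂ (Fin (N + 1))) : Prop :=
  AnalyticAt ℂ F z ∧ ∀ᶠ w in 𝓝 z, ∃ h : F w ≠ 0, Projectivization.mk ℂ (F w) h = f w

/-- A map `f : ℂ → ℂP^N` is holomorphic if near every point it is given by holomorphic
homogeneous coordinates without common zeros. -/
def IsHolomorphic {N : ℕ} (f : ℂ → CP N) : Prop :=
  ∀ z : ℂ, ∃ F : ℂ → EuclideanSpace ℂ (Fin (N + 1)), IsLocalLift f z F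

/-- The expression `(1 / 4π) Δ log (|F₀|² + … + |F_N|²)` at `z`, with
`Δ = ∂²/∂x² + ∂²/∂y²`. -/
noncomputable def laplaceLog {N : ℕ} (F : ℂ → EuclideanSpace ℂ (Fin (N + 1))) (z : ℂ) : ℝ :=
  1 / (4 * Real.pi) *
    Laplacian.laplacian (fun w : ℂ => Real.log (∑ i, ‖F w i‖ ^ 2)) z

open Classical in
/-- The spherical derivative `|df|(z) ≥ 0`, where
`|df|²(z) = (1 / 4π) Δ log (|F₀|² + … + |F_N|²) (z)` for holomorphic homogeneous coordinates
`F` of `f` near `z`. By `sphericalDeriv_eq` below, all choices of `F` give the same value. -/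
noncomputable def sphericalDeriv {N : ℕ} (f : ℂ → CP N) (z : ℂ) : ℝ :=
  if h : ∃ F, IsLocalLift f z F then Real.sqrt (laplaceLog h.choose z) else 0

theorem laplaceLog_eq_of_isLocalLift {N : ℕ} {f : ℂ → CP N} {z : ℂ}
    {F G : ℂ → EuclideanSpace ℂ (Fin (N + 1))}
    (hF : IsLocalLift f z F) (hG : IsLocalLift f z G) : laplaceLog F z = laplaceLog G z := by
  obtain ⟨hFa, hFe⟩ := hF
  obtain ⟨hGa, hGe⟩ := hG
  obtain ⟨hG0, -⟩ := hGe.self_of_nhds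
  obtain ⟨i, hi⟩ : ∃ i, G z i ≠ 0 := by
    by_contra! hcon
    exact hG0 (by ext i; simpa using hcon i)
  have coord : ∀ {H : ℂ → EuclideanSpace ℂ (Fin (N + 1))}, AnalyticAt ℂ H z → ∀ j,
      AnalyticAt ℂ (fun w => H w j) z := fun {H} hH j =>
    ((EuclideanSpace.proj j : EuclideanSpace ℂ (Fin (N + 1)) →L[ℂ] ℂ).analyticAt _).comp hH
  set c : ℂ → ℂ := fun w => F w i / G w i with hc
  have hca : AnalyticAt ℂ c z := (coord hFa i).div (coord hGa i) hi
  have hGi : ∀ᶠ w in 𝓝 z, G w i ≠ 0 := (coord hGa i).continuousAt.eventually_ne hi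
  have key : ∀ᶠ w in 𝓝 z, G w ≠ 0 ∧ c w ≠ 0 ∧ F w = c w • G w := by
    filter_upwards [hFe, hGe, hGi] with w hFw hGw hw
    obtain ⟨h1, e1⟩ := hFw
    obtain ⟨h2, e2⟩ := hGw
    obtain ⟨a, ha⟩ := (Projectivization.mk_eq_mk_iff' ℂ _ _ h1 h2).1 (e1.trans e2.symm)
    have hac : c w = a := by
      simp only [hc]
      rw [← ha]
      simp [hw]
    refine ⟨h2, ?_, by rw [hac, ha]⟩
    rw [hac]
    rintro rfl
    exact h1 (by rw [← ha, zero_smul])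
  have hsum : ∀ v : EuclideanSpace ℂ (Fin (N + 1)), ∑ j, ‖v j‖ ^ 2 = ‖v‖ ^ 2 := fun v =>
    (EuclideanSpace.norm_sq_eq v).symm
  have hlog : (fun w => Real.log (∑ j, ‖F w j‖ ^ 2)) =ᶠ[𝓝 z]
      ((2 : ℝ) • fun w => Real.log ‖c w‖) + fun w => Real.log (∑ j, ‖G w j‖ ^ 2) := by
    filter_upwards [key] with w hw
    obtain ⟨h1, h2, h3⟩ := hw
    simp only [hsum, Pi.add_apply, Pi.smul_apply, smul_eq_mul]
    rw [h3, norm_smul, mul_pow, Real.log_mul (by simpa using h2) (by simpa using h1),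
      Real.log_pow]
    simp
  have hharm : InnerProductSpace.HarmonicAt (fun w => Real.log ‖c w‖) z :=
    hca.harmonicAt_log_norm key.self_of_nhds.2.1
  have hGs : ContDiffAt ℝ 2 (fun w => Real.log (∑ j, ‖G w j‖ ^ 2)) z := by
    refine ContDiffAt.log ?_ (by rw [hsum]; simpa using hG0)
    refine ContDiffAt.sum fun j _ => ?_
    exact ((coord hGa j).contDiffAt.restrict_scalars ℝ).norm_sq ℝ
  have hharm2 := hharm.const_smul (c := (2 : ℝ))
  unfold laplaceLog
  rw [(InnerProductSpace.laplacian_congr_nhds hlog).self_of_nhds,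
    ContDiffAt.laplacian_add hharm2.1 hGs, hharm2.2.self_of_nhds]
  simp

/-- The spherical derivative does not depend on the choice of homogeneous coordinates. -/
theorem sphericalDeriv_eq {N : ℕ} {f : ℂ → CP N} {z : ℂ}
    {F : ℂ → EuclideanSpace ℂ (Fin (N + 1))} (hF : IsLocalLift f z F) :
    sphericalDeriv f z = Real.sqrt (laplaceLog F z) := by
  have h : ∃ F, IsLocalLift f z F := ⟨F, hF⟩
  rw [sphericalDeriv, dif_pos h, laplaceLog_eq_of_isLocalLift h.choose_spec hF]

/-- The supremum norm of `|df|` over a set `D`, with values in `[0, ∞]`. -/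
noncomputable def derivSupNorm {N : ℕ} (f : ℂ → CP N) (D : Set ℂ) : ℝ≥0∞ :=
  ⨆ z ∈ D, ENNReal.ofReal (sphericalDeriv f z)

/-- A Brody curve: a holomorphic map `ℂ → ℂP^N` with `|df| ≤ 1` everywhere. -/
def IsBrodyCurve {N : ℕ} (f : ℂ → CP N) : Prop :=
  IsHolomorphic f ∧ ∀ z : ℂ, sphericalDeriv f z ≤ 1

/-- A non-degenerate Brody curve: for some `δ > 0` and `R > 0`, the supremum of `|df|` over
every closed disk of radius `R` is at least `δ`. -/
def IsNondegenerateBrodyCurve {N : ℕ} (f : ℂ → CP N) : Prop :=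
  IsBrodyCurve f ∧ ∃ δ : ℝ, 0 < δ ∧ ∃ R : ℝ, 0 < R ∧
    ∀ a : ℂ, ENNReal.ofReal δ ≤ derivSupNorm f (Metric.closedBall a R)

/-- `(1 / πR²) sup_{a ∈ ℂ} ∫_{|z - a| < R} |df|² dxdy`. -/
noncomputable def meanEnergy {N : ℕ} (f : ℂ → CP N) (R : ℝ) : ℝ :=
  1 / (Real.pi * R ^ 2) * ⨆ a : ℂ, ∫ z in Metric.ball a R, sphericalDeriv f z ^ 2

/-- The energy density `ρ(f) = lim_{R → ∞} (1 / πR²) sup_a ∫_{|z - a| < R} |df|² dxdy`. -/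
noncomputable def energyDensity {N : ℕ} (f : ℂ → CP N) : ℝ :=
  limUnder atTop (meanEnergy f)

end BrodyCurves

/-! A curve degenerates only on large disks where `|df|` is tiny, so small rational bubbles are
inserted there and `f` is left almost unchanged elsewhere. Fix a lattice `M ℤ[i]` with `M` large and
let `P` be the lattice points `Mn` such that `|df| ≤ δ = 1/(1000M)` on the disk of radius `M`. With
`v n` a unit vector spanning `f(Mn)` and `u n` a unit vector orthogonal to it (available since `N ≥
1`), put `g = [(1 + S) f]`, where `S(z) = ∑ (100/(z - Mn))⁴ ⟨v n, ·⟩ u n` over `P`. Since `S(z)` is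
a linear operator, `g` does not depend on the lift of `f`, and no global lift is needed.

At distance at least `M/2` from the poles, `S` and its derivative are at most `η = O(M⁻⁴)`, and
`|dg|` differs from `|df|` by at most `10η` (`far_estimates`). Near a pole, `f` is almost the
constant `[v]`, and `g` is close to the rational curve `[v + h u]` with `h = (100/(z - Mn))⁴`. The
factor 100 keeps its derivative small, yet it is bounded below on the circle of radius 100
(`near_estimates`).

Nondegeneracy follows because a disk that is not flat contains a point with `|df| > δ`, and `η =
O(M⁻⁴)` is negligible against `δ ~ 1/M`. The energy hardly drops: `|dg|` can be much smaller than
`|df|` only where `|df| ≤ δ`, so `|df|² ≤ |dg|² + ε` pointwise, and averaging gives the claim on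
`ρ`. Existence of the limits is a Fubini argument (`ballIntegral_averaging`). -/

namespace BrodyCurves

/-! ### The Fubini–Study norm and the Laplacian of `log ‖F‖²`. -/

section FubiniStudy

variable {E : Type*} [NormedAddCommGroup E] [InnerProductSpace ℂ E]

/-- The Fubini–Study length of the tangent vector of `ℙ(E)` at `[x]` represented by `y`. -/
noncomputable def fsDeriv (x y : E) : ℝ :=
  ‖y - (inner ℂ x y / (‖x‖ : ℂ) ^ 2) • x‖ / ‖x‖

theorem fsDeriv_nonneg (x y : E) : 0 ≤ fsDeriv x y := by
  unfold fsDeriv; positivity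

theorem inner_sub_proj {x : E} (hx : x ≠ 0) (y : E) :
    inner ℂ x (y - (inner ℂ x y / (‖x‖ : ℂ) ^ 2) • x) = 0 := by
  have h : (‖x‖ : ℂ) ≠ 0 := by simpa using hx
  rw [inner_sub_right, inner_smul_right, inner_self_eq_norm_sq_to_K]
  simp only [Complex.coe_algebraMap]
  field_simp
  simp

/-- Orthogonal projection minimises distance: `fsDeriv x y * ‖x‖` is the distance from `y` to the
line `ℂ x`. All later upper bounds come from choosing a good `c`, and all lower bounds from treating
every `c` (`le_fsDeriv`). -/
theorem fsDeriv_le {x : E} (hx : x ≠ 0) (y : E) (c : ℂ) :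
    fsDeriv x y ≤ ‖y - c • x‖ / ‖x‖ := by
  unfold fsDeriv
  gcongr
  set c₀ := inner ℂ x y / (‖x‖ : ℂ) ^ 2 with hc₀
  have h0 : inner ℂ (y - c₀ • x) ((c₀ - c) • x) = 0 := by
    rw [inner_smul_right, inner_eq_zero_symm.1 (inner_sub_proj hx y), mul_zero]
  have h1 : y - c • x = (y - c₀ • x) + (c₀ - c) • x := by rw [sub_smul]; abel
  have h2 := norm_add_sq_eq_norm_sq_add_norm_sq_of_inner_eq_zero _ _ h0
  rw [h1]
  nlinarith [norm_nonneg (y - c₀ • x), norm_nonneg ((c₀ - c) • x),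
    norm_nonneg ((y - c₀ • x) + (c₀ - c) • x)]

theorem exists_fsDeriv_eq {x : E} (hx : x ≠ 0) (y : E) :
    ∃ c : ℂ, inner ℂ x (y - c • x) = 0 ∧ ‖y - c • x‖ = fsDeriv x y * ‖x‖ := by
  refine ⟨_, inner_sub_proj hx y, ?_⟩
  rw [fsDeriv, div_mul_cancel₀ _ (by simpa using hx)]

theorem le_fsDeriv {x y : E} (hx : x ≠ 0) {m : ℝ} (h : ∀ c : ℂ, m * ‖x‖ ≤ ‖y - c • x‖) :
    m ≤ fsDeriv x y := by
  rw [fsDeriv, le_div_iff₀ (by simpa using hx)]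
  exact h _

/-- Together with `fsDeriv_smul` this is invariance under a change of lift, since `(aF)' = aF' +
a'F`. -/
theorem fsDeriv_sub_smul {x : E} (hx : x ≠ 0) (y : E) (c : ℂ) :
    fsDeriv x (y - c • x) = fsDeriv x y := by
  have key : ∀ (y : E) (c : ℂ), fsDeriv x (y - c • x) ≤ fsDeriv x y := fun y c => by
    refine le_fsDeriv hx fun a => ?_
    have := fsDeriv_le hx (y - c • x) (a - c)
    rw [le_div_iff₀ (by simpa using hx)] at this
    rwa [show y - c • x - (a - c) • x = y - a • x by rw [sub_smul]; abel] at this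
  refine le_antisymm (key y c) ?_
  simpa [sub_smul] using key (y - c • x) (-c)

theorem fsDeriv_smul (x y : E) {s : ℂ} (hs : s ≠ 0) :
    fsDeriv (s • x) (s • y) = fsDeriv x y := by
  rcases eq_or_ne x 0 with rfl | hx
  · simp [fsDeriv]
  have key : ∀ {x : E} (y : E) {s : ℂ}, x ≠ 0 → s ≠ 0 →
      fsDeriv (s • x) (s • y) ≤ fsDeriv x y := fun {x} y {s} hx hs => by
    refine le_fsDeriv hx fun a => ?_
    have hsx : s • x ≠ 0 := smul_ne_zero hs hx
    have := fsDeriv_le hsx (s • y) a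
    rw [le_div_iff₀ (by simpa using hsx), smul_comm a, ← smul_sub, norm_smul, norm_smul] at this
    have h0 : 0 < ‖s‖ := by simpa using hs
    nlinarith
  refine le_antisymm (key y hx hs) ?_
  simpa [smul_smul, hs] using key (s • y) (smul_ne_zero hs hx) (inv_ne_zero hs)

theorem fsDeriv_sq {x : E} (hx : x ≠ 0) (y : E) :
    fsDeriv x y ^ 2 = ‖y‖ ^ 2 / ‖x‖ ^ 2 - ‖inner ℂ x y‖ ^ 2 / ‖x‖ ^ 4 := by
  have h : ‖x‖ ≠ 0 := by simpa using hx
  set c := inner ℂ x y / (‖x‖ : ℂ) ^ 2 with hc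
  have h0 : inner ℂ (y - c • x) (c • x) = 0 := by
    rw [inner_smul_right, inner_eq_zero_symm.1 (inner_sub_proj hx y), mul_zero]
  have h2 := norm_add_sq_eq_norm_sq_add_norm_sq_of_inner_eq_zero _ _ h0
  rw [sub_add_cancel, norm_smul, hc, norm_div, norm_pow, Complex.norm_real, norm_norm] at h2
  rw [fsDeriv, div_pow, pow_two ‖y - _‖, eq_sub_of_add_eq h2.symm]
  field_simp

/-- The real linear form `ξ ↦ re (c ξ)`. -/
noncomputable def reMul (c : ℂ) : ℂ →L[ℝ] ℝ :=
  Complex.reCLM.comp (ContinuousLinearMap.mul ℝ ℂ c)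

theorem reMul_apply (c ξ : ℂ) : reMul c ξ = (c * ξ).re := rfl

theorem hasFDerivAt_norm_sq {F : ℂ → E} {F' : E} {z : ℂ} (h : HasDerivAt F F' z) :
    HasFDerivAt (fun w => ‖F w‖ ^ 2) (reMul (2 * inner ℂ (F z) F')) z := by
  have h1 := h.hasFDerivAt.restrictScalars ℝ
  have h2 := Complex.reCLM.hasFDerivAt.comp z (h1.inner ℂ h1)
  have e : (fun w => ‖F w‖ ^ 2) = Complex.reCLM ∘ fun w => inner ℂ (F w) (F w) := by
    ext w; simpa using (inner_self_eq_norm_sq (𝕜 := ℂ) (F w)).symm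
  rw [e]
  refine h2.congr_fderiv ?_
  ext ξ
  have h3 := inner_re_symm (𝕜 := ℂ) F' (F z)
  have h4 := inner_im_symm (𝕜 := ℂ) F' (F z)
  simp at h3 h4
  simp [reMul_apply, inner_smul_right, inner_smul_left, h3, h4]
  ring

theorem hasFDerivAt_log_norm_sq {F : ℂ → E} {F' : E} {z : ℂ} (h : HasDerivAt F F' z)
    (h0 : F z ≠ 0) :
    HasFDerivAt (fun w => Real.log (‖F w‖ ^ 2))
      (reMul (2 * inner ℂ (F z) F' / (‖F z‖ ^ 2 : ℝ))) z := by
  refine ((hasFDerivAt_norm_sq h).log (by simpa using h0)).congr_fderiv ?_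
  ext
  simp [reMul_apply, div_eq_inv_mul, -Complex.ofReal_pow, ← Complex.ofReal_inv]
  ring

/-- The differential is `ξ ↦ re (c ξ)` with `c = 2⟨F, F'⟩/‖F‖²`, so the Laplacian is the real part
of `2 ∂̄c`. The terms with `F''` cancel between the directions `1` and `i`, and `fsDeriv_sq`
identifies the rest. -/
theorem laplacian_log_norm_sq [CompleteSpace E] {F : ℂ → E} {z : ℂ} (hF : AnalyticAt ℂ F z)
    (h0 : F z ≠ 0) :
    Laplacian.laplacian (fun w => Real.log (‖F w‖ ^ 2)) z =
      4 * fsDeriv (F z) (deriv F z) ^ 2 := by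
  have hev : ∀ᶠ w in 𝓝 z, fderiv ℝ (fun w => Real.log (‖F w‖ ^ 2)) w =
      reMul (2 * inner ℂ (F w) (deriv F w) / (‖F w‖ ^ 2 : ℝ)) := by
    filter_upwards [hF.eventually_analyticAt, hF.continuousAt.eventually_ne h0] with w h1 h2
    exact (hasFDerivAt_log_norm_sq h1.differentiableAt.hasDerivAt h2).fderiv
  have hn : (‖F z‖ : ℂ) ≠ 0 := by simpa using h0
  have hn' : ‖F z‖ ≠ 0 := by simpa using h0
  have h1 := hF.differentiableAt.hasDerivAt.hasFDerivAt.restrictScalars ℝ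
  have h2 := hF.deriv.differentiableAt.hasDerivAt.hasFDerivAt.restrictScalars ℝ
  have h3 := (h1.inner ℂ h2).const_mul 2
  have h4 := ((hasDerivAt_inv (pow_ne_zero 2 hn')).comp_hasFDerivAt z
    (hasFDerivAt_norm_sq hF.differentiableAt.hasDerivAt)).smul h3
  have h5 : ∀ x, HasFDerivAt (fun c : ℂ => reMul c)
      ((ContinuousLinearMap.compL ℝ ℂ ℂ ℝ Complex.reCLM).comp (ContinuousLinearMap.mul ℝ ℂ)) x :=
    fun _ => ((ContinuousLinearMap.compL ℝ ℂ ℂ ℝ Complex.reCLM).comp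
      (ContinuousLinearMap.mul ℝ ℂ)).hasFDerivAt
  have h6 := (h5 _).comp z h4
  have h7 : fderiv ℝ (fun w => Real.log (‖F w‖ ^ 2)) =ᶠ[𝓝 z] ((fun c => reMul c) ∘
      (((fun y => y⁻¹) ∘ fun w => ‖F w‖ ^ 2) • fun y => 2 * inner ℂ (F y) (deriv F y))) := by
    filter_upwards [hev] with w hw
    rw [hw]
    simp [div_eq_inv_mul, Complex.real_smul]
  have h8 := h7.fderiv_eq.trans h6.fderiv
  rw [InnerProductSpace.laplacian_eq_iteratedFDeriv_complexPlane]
  simp only [iteratedFDeriv_two_apply, h8]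
  rw [fsDeriv_sq h0]
  have e1 := inner_self_eq_norm_sq (𝕜 := ℂ) (deriv F z)
  simp only [RCLike.re_to_complex] at e1
  rw [← Complex.normSq_eq_norm_sq (inner ℂ _ _), Complex.normSq_apply, ← e1]
  simp [reMul_apply, inner_smul_right, inner_smul_left]
  simp only [← Complex.ofReal_pow, Complex.ofReal_re, Complex.ofReal_im]
  field_simp
  ring

end FubiniStudy

/-! ### The spherical derivative through lifts, and how far the curve moves. -/

section Lifts

variable {N : ℕ} {f : ℂ → CP N} {z : ℂ} {F : ℂ → EuclideanSpace ℂ (Fin (N + 1))}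

theorem IsLocalLift.ne_zero (hF : IsLocalLift f z F) : F z ≠ 0 :=
  hF.2.self_of_nhds.1

theorem IsLocalLift.eventually (hF : IsLocalLift f z F) : ∀ᶠ w in 𝓝 z, IsLocalLift f w F :=
  hF.1.eventually_analyticAt.and hF.2.eventually_nhds

theorem sphericalDeriv_eq_fsDeriv (hF : IsLocalLift f z F) :
    sphericalDeriv f z = fsDeriv (F z) (deriv F z) / Real.sqrt Real.pi := by
  have h : (fun w : ℂ => Real.log (∑ i, ‖F w i‖ ^ 2)) = fun w => Real.log (‖F w‖ ^ 2) := by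
    ext w; rw [EuclideanSpace.norm_sq_eq]
  rw [sphericalDeriv_eq hF, laplaceLog, h, laplacian_log_norm_sq hF.1 hF.ne_zero,
    show 1 / (4 * Real.pi) * (4 * fsDeriv (F z) (deriv F z) ^ 2) =
      fsDeriv (F z) (deriv F z) ^ 2 / Real.pi by field_simp,
    Real.sqrt_div (sq_nonneg _), Real.sqrt_sq (fsDeriv_nonneg _ _)]

theorem sphericalDeriv_nonneg (f : ℂ → CP N) (z : ℂ) : 0 ≤ sphericalDeriv f z := by
  unfold sphericalDeriv
  split_ifs
  · positivity
  · exact le_rfl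

theorem IsHolomorphic.continuous_sphericalDeriv (hf : IsHolomorphic f) :
    Continuous (sphericalDeriv f) := by
  refine continuous_iff_continuousAt.2 fun z => ?_
  obtain ⟨F, hF⟩ := hf z
  have h1 : ContinuousAt (fun w => fsDeriv (F w) (deriv F w) / Real.sqrt Real.pi) z := by
    have hc := hF.1.continuousAt
    have hc' := hF.1.deriv.continuousAt
    have hn : ‖F z‖ ≠ 0 := by simpa using hF.ne_zero
    have hn' : (‖F z‖ : ℂ) ^ 2 ≠ 0 := by simpa using hF.ne_zero
    have hi : ContinuousAt (fun w => inner ℂ (F w) (deriv F w)) z := hc.inner hc'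
    have hnc : ContinuousAt (fun w => (‖F w‖ : ℂ) ^ 2) z :=
      (Complex.continuous_ofReal.continuousAt.comp hc.norm).pow 2
    exact (((hc'.sub ((hi.div hnc hn').smul hc)).norm).div hc.norm hn).div_const _
  refine h1.congr ?_
  filter_upwards [hF.eventually] with w hw using (sphericalDeriv_eq_fsDeriv hw).symm

/-- The squared cosine of the angle between the vector `v` and the line `p`. -/
noncomputable def cosSq (v : EuclideanSpace ℂ (Fin (N + 1))) (p : CP N) : ℝ :=
  ‖inner ℂ v p.rep‖ ^ 2 / ‖p.rep‖ ^ 2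

theorem cosSq_mk (v : EuclideanSpace ℂ (Fin (N + 1))) {x : EuclideanSpace ℂ (Fin (N + 1))}
    (hx : x ≠ 0) : cosSq v (Projectivization.mk ℂ x hx) = ‖inner ℂ v x‖ ^ 2 / ‖x‖ ^ 2 := by
  obtain ⟨a, ha⟩ := Projectivization.exists_smul_eq_mk_rep ℂ x hx
  have ha0 : ‖(a : ℂ)‖ ≠ 0 := by simp
  rw [cosSq, ← ha, Units.smul_def, inner_smul_right, norm_smul, norm_mul]
  have : ‖x‖ ≠ 0 := by simpa using hx
  field_simp

/-- The quotient `‖⟨v, F⟩‖²/‖F‖²` is homogeneous of degree 0, so only the component of `F'`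
orthogonal to `F` contributes, and its length is `fsDeriv * ‖F‖`. Integrated over a disk, this
measures how far `f` moves without a metric on `CP N`. -/
theorem hasFDerivAt_cosSq_bound (hF : IsLocalLift f z F)
    {v : EuclideanSpace ℂ (Fin (N + 1))} (hv : ‖v‖ = 1) :
    ∃ L : ℂ →L[ℝ] ℝ, HasFDerivAt (fun w => cosSq v (f w)) L z ∧
      ‖L‖ ≤ 2 * Real.sqrt Real.pi * sphericalDeriv f z := by
  have h0 := hF.ne_zero
  have hn : ‖F z‖ ≠ 0 := by simpa using h0
  have hd := hF.1.differentiableAt.hasDerivAt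
  have hv1 : HasDerivAt (fun w => inner ℂ v (F w)) (inner ℂ v (deriv F z)) z :=
    ((innerSL ℂ v).hasFDerivAt.comp_hasDerivAt z hd)
  have h1 := (hasFDerivAt_norm_sq hv1).mul ((hasDerivAt_inv (pow_ne_zero 2 hn)).comp_hasFDerivAt z
    (hasFDerivAt_norm_sq hd))
  have h2 : (fun w => cosSq v (f w)) =ᶠ[𝓝 z]
      ((fun w => ‖inner ℂ v (F w)‖ ^ 2) * ((fun y => y⁻¹) ∘ fun w => ‖F w‖ ^ 2)) := by
    filter_upwards [hF.2] with w hw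
    obtain ⟨hw0, hw1⟩ := hw
    rw [← hw1, cosSq_mk]
    simp [div_eq_mul_inv]
  refine ⟨_, h1.congr_of_eventuallyEq h2, ?_⟩
  refine ContinuousLinearMap.opNorm_le_bound _
    (mul_nonneg (by positivity) (sphericalDeriv_nonneg f z)) fun ξ => ?_
  obtain ⟨c, hc, hcn⟩ := exists_fsDeriv_eq h0 (deriv F z)
  set y := deriv F z - c • F z with hy
  have hy' : deriv F z = y + c • F z := by rw [hy]; abel
  have hin : inner ℂ (F z) (deriv F z) = c * (‖F z‖ : ℂ) ^ 2 := by
    rw [hy', inner_add_right, hc, inner_smul_right, inner_self_eq_norm_sq_to_K]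
    simp
  have hiv : inner ℂ v (deriv F z) = inner ℂ v y + c * inner ℂ v (F z) := by
    rw [hy', inner_add_right, inner_smul_right]
  rw [sphericalDeriv_eq_fsDeriv hF, show 2 * Real.sqrt Real.pi * (fsDeriv (F z) (deriv F z) /
    Real.sqrt Real.pi) = 2 * fsDeriv (F z) (deriv F z) by field_simp]
  rw [hiv, hin]
  set p := inner ℂ v (F z) with hp
  set q := inner ℂ v y with hq
  -- The contributions of the tangential part `c • F z` cancel.
  have e : ∀ t : ℝ, t = ‖F z‖ → (‖p‖ ^ 2 * (-((t ^ 2) ^ 2)⁻¹ * (2 * (c * (t : ℂ) ^ 2) * ξ).re) +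
      (t ^ 2)⁻¹ * (2 * ((starRingEnd ℂ) p * (q + c * p)) * ξ).re) =
      (t ^ 2)⁻¹ * (2 * ((starRingEnd ℂ) p * q) * ξ).re := by
    intro t ht
    have ht0 : t ≠ 0 := by rw [ht]; exact hn
    rw [← Complex.normSq_eq_norm_sq, Complex.normSq_apply]
    simp [← Complex.ofReal_pow]
    field_simp
    ring
  have e2 : ‖(‖F z‖ ^ 2)⁻¹ * (2 * ((starRingEnd ℂ) p * q) * ξ).re‖ ≤
      2 * fsDeriv (F z) (deriv F z) * ‖ξ‖ := by
    have hpn : ‖p‖ ≤ ‖F z‖ := by simpa [hv] using norm_inner_le_norm (𝕜 := ℂ) v (F z)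
    have hqn : ‖q‖ ≤ fsDeriv (F z) (deriv F z) * ‖F z‖ := by
      rw [← hcn]; simpa [hv] using norm_inner_le_norm (𝕜 := ℂ) v y
    have h3 := Complex.abs_re_le_norm (2 * ((starRingEnd ℂ) p * q) * ξ)
    rw [norm_mul, norm_mul, norm_mul, RCLike.norm_conj, Complex.norm_ofNat] at h3
    have h4 : ‖p‖ * ‖q‖ ≤ ‖F z‖ * (fsDeriv (F z) (deriv F z) * ‖F z‖) := by gcongr
    rw [norm_mul, Real.norm_eq_abs ((_ : ℂ).re), norm_inv, norm_pow, norm_norm,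
      inv_mul_le_iff₀ (by positivity)]
    refine h3.trans ?_
    calc 2 * (‖p‖ * ‖q‖) * ‖ξ‖ ≤ 2 * (‖F z‖ * (fsDeriv (F z) (deriv F z) * ‖F z‖)) * ‖ξ‖ := by
          gcongr
      _ = _ := by ring
  refine le_trans (le_of_eq (congrArg _ ?_)) e2
  rw [← e _ rfl]
  simp [reMul_apply]
  left
  ring

theorem abs_cosSq_sub_le (hf : IsHolomorphic f) {v : EuclideanSpace ℂ (Fin (N + 1))}
    (hv : ‖v‖ = 1) {b : ℂ} {M d : ℝ}
    (hd : ∀ w ∈ Metric.closedBall b M, sphericalDeriv f w ≤ d) (hz : z ∈ Metric.closedBall b M) :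
    |cosSq v (f z) - cosSq v (f b)| ≤ 2 * Real.sqrt Real.pi * d * ‖z - b‖ := by
  choose F hF using hf
  choose L hL hLn using fun w => hasFDerivAt_cosSq_bound (hF w) hv
  refine (convex_closedBall b M).norm_image_sub_le_of_norm_hasFDerivWithin_le
    (fun w _ => (hL w).hasFDerivWithinAt) (fun w hw => (hLn w).trans ?_)
    (Metric.mem_closedBall_self (dist_nonneg.trans (Metric.mem_closedBall.1 hz))) hz
  gcongr
  exact hd w hw

end Lifts

/-! ### Existence of the energy density and its comparison for two curves. -/

section Averages

/-- `sup_a ∫_{|z - a| < R} φ`. -/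
noncomputable def supBallIntegral (φ : ℂ → ℝ) (R : ℝ) : ℝ := ⨆ a : ℂ, ∫ z in Metric.ball a R, φ z

variable {φ : ℂ → ℝ} {K : ℝ}

theorem integrableOn_ball (hφ : Continuous φ) (a : ℂ) (R : ℝ) :
    IntegrableOn φ (Metric.ball a R) :=
  (hφ.continuousOn.integrableOn_compact (isCompact_closedBall a R)).mono_set
    Metric.ball_subset_closedBall

theorem volume_real_ball (a : ℂ) {R : ℝ} (hR : 0 ≤ R) :
    volume.real (Metric.ball a R) = Real.pi * R ^ 2 := by
  simp [Measure.real, Complex.volume_ball, hR, mul_comm]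

theorem setIntegral_ball_le (hφ : Continuous φ) (h1 : ∀ z, φ z ≤ K) (a : ℂ) {R : ℝ}
    (hR : 0 ≤ R) : ∫ z in Metric.ball a R, φ z ≤ K * (Real.pi * R ^ 2) := by
  refine (setIntegral_mono_on (integrableOn_ball hφ a R)
    (integrableOn_const (by simp [Complex.volume_ball, ENNReal.mul_eq_top]) (by simp))
    measurableSet_ball fun z _ => h1 z).trans ?_
  rw [setIntegral_const, volume_real_ball a hR, smul_eq_mul, mul_comm]

theorem bddAbove_ballIntegral (hφ : Continuous φ) (h1 : ∀ z, φ z ≤ K) {R : ℝ} (hR : 0 ≤ R) :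
    BddAbove (Set.range fun a : ℂ => ∫ z in Metric.ball a R, φ z) :=
  ⟨K * (Real.pi * R ^ 2), by rintro _ ⟨a, rfl⟩; exact setIntegral_ball_le hφ h1 a hR⟩

theorem supBallIntegral_nonneg (h0 : ∀ z, 0 ≤ φ z) (R : ℝ) : 0 ≤ supBallIntegral φ R :=
  Real.iSup_nonneg fun _ => setIntegral_nonneg measurableSet_ball fun z _ => h0 z

/-- Integrate `φ z` over the pairs `(z, c)` with `|z - c| < R` and `|z - a| < R'`. Integrating over
`c` first gives the left side. Integrating over `z` first gives at most `supBallIntegral φ R` for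
each `c`, and only `c` within `R + R'` of `a` contribute. -/
theorem ballIntegral_averaging (hφ : Continuous φ) (h0 : ∀ z, 0 ≤ φ z) (h1 : ∀ z, φ z ≤ K)
    (a : ℂ) {R R' : ℝ} (hR : 0 ≤ R) (hR' : 0 ≤ R') :
    Real.pi * R ^ 2 * ∫ z in Metric.ball a R', φ z ≤
      Real.pi * (R + R') ^ 2 * supBallIntegral φ R := by
  set ψ : ℂ → ℝ≥0∞ := fun z => ENNReal.ofReal (φ z) with hψ
  have hψm : Measurable ψ := hφ.measurable.ennreal_ofReal
  have hint : ∀ c r, ∫⁻ z in Metric.ball c r, ψ z =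
      ENNReal.ofReal (∫ z in Metric.ball c r, φ z) := fun c r =>
    (ofReal_integral_eq_lintegral_ofReal (integrableOn_ball hφ c r)
      (Eventually.of_forall h0)).symm
  have hvol : ∀ (c : ℂ) {r : ℝ}, 0 ≤ r → volume (Metric.ball c r) =
      ENNReal.ofReal (Real.pi * r ^ 2) := fun c r hr => by
    rw [← volume_real_ball c hr, ofReal_measureReal (by simp [Complex.volume_ball, ENNReal.mul_eq_top])]
  let G : ℂ → ℂ → ℝ≥0∞ := fun z c =>
    {p : ℂ × ℂ | dist p.1 p.2 < R ∧ dist p.1 a < R'}.indicator (fun p => ψ p.1) (z, c)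
  have hset : MeasurableSet {p : ℂ × ℂ | dist p.1 p.2 < R ∧ dist p.1 a < R'} :=
    (measurableSet_lt (measurable_fst.dist measurable_snd) measurable_const).inter
      (measurableSet_lt (measurable_fst.dist measurable_const) measurable_const)
  have hG : Measurable (Function.uncurry G) :=
    (hψm.comp measurable_fst).indicator hset
  have hswap := lintegral_lintegral_swap (μ := (volume : Measure ℂ)) (ν := (volume : Measure ℂ))
    hG.aemeasurable
  have hleft : ∫⁻ z, ∫⁻ c, G z c =
      ENNReal.ofReal (Real.pi * R ^ 2 * ∫ z in Metric.ball a R', φ z) := by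
    have e1 : ∀ z, ∫⁻ c, G z c = (Metric.ball a R').indicator
        (fun z => ENNReal.ofReal (Real.pi * R ^ 2) * ψ z) z := fun z => by
      by_cases hz : z ∈ Metric.ball a R'
      · have : ∀ c, G z c = (Metric.ball z R).indicator (fun _ => ψ z) c := fun c => by
          have hz' : dist z a < R' := hz
          by_cases hc : dist z c < R
          · have : c ∈ Metric.ball z R := Metric.mem_ball'.2 hc
            simp [G, hz', hc, this]
          · have : c ∉ Metric.ball z R := fun h => hc (Metric.mem_ball'.1 h)
            simp [G, hc, this]
        simp_rw [this]
        rw [lintegral_indicator measurableSet_ball, lintegral_const, Measure.restrict_apply_univ,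
          hvol z hR, Set.indicator_of_mem hz, mul_comm]
      · have hz' : ¬ dist z a < R' := hz
        rw [Set.indicator_of_notMem hz]
        simp [G, hz']
    simp_rw [e1]
    rw [lintegral_indicator measurableSet_ball, lintegral_const_mul _ hψm, hint,
      ← ENNReal.ofReal_mul (by positivity)]
  have hright : ∫⁻ c, ∫⁻ z, G z c ≤
      ENNReal.ofReal (Real.pi * (R + R') ^ 2 * supBallIntegral φ R) := by
    have e1 : ∀ c, ∫⁻ z, G z c ≤ (Metric.ball a (R + R')).indicator
        (fun _ => ENNReal.ofReal (supBallIntegral φ R)) c := fun c => by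
      by_cases hc : c ∈ Metric.ball a (R + R')
      · rw [Set.indicator_of_mem hc]
        calc ∫⁻ z, G z c ≤ ∫⁻ z, (Metric.ball c R).indicator ψ z := by
              refine lintegral_mono fun z => ?_
              by_cases hz : dist z c < R ∧ dist z a < R'
              · have : z ∈ Metric.ball c R := hz.1
                simp [G, hz, this]
              · simp [G, hz]
          _ = ENNReal.ofReal (∫ z in Metric.ball c R, φ z) := by
              rw [lintegral_indicator measurableSet_ball, hint]
          _ ≤ _ := ENNReal.ofReal_le_ofReal (le_ciSup (bddAbove_ballIntegral hφ h1 hR) c)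
      · have hc' : ∀ z, ¬ (dist z c < R ∧ dist z a < R') := fun z hz => hc <| by
          rw [Metric.mem_ball]
          linarith [dist_triangle_left c a z]
        simp [G, hc']
    refine (lintegral_mono e1).trans ?_
    rw [lintegral_indicator measurableSet_ball, setLIntegral_const, hvol a (by positivity),
      mul_comm, ← ENNReal.ofReal_mul (by positivity)]
  rw [hswap] at hleft
  rw [hleft] at hright
  exact (ENNReal.ofReal_le_ofReal_iff
    (mul_nonneg (by positivity) (supBallIntegral_nonneg h0 R))).1 hright

theorem supBallIntegral_averaging (hφ : Continuous φ) (h0 : ∀ z, 0 ≤ φ z) (h1 : ∀ z, φ z ≤ K)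
    {R R' : ℝ} (hR : 0 < R) (hR' : 0 < R') :
    1 / (Real.pi * R' ^ 2) * supBallIntegral φ R' ≤
      (1 + R / R') ^ 2 * (1 / (Real.pi * R ^ 2) * supBallIntegral φ R) := by
  have h : supBallIntegral φ R' ≤ (R + R') ^ 2 / R ^ 2 * supBallIntegral φ R := by
    refine ciSup_le fun a => ?_
    have := ballIntegral_averaging hφ h0 h1 a hR.le hR'.le
    rw [mul_assoc, mul_assoc, mul_le_mul_iff_right₀ Real.pi_pos] at this
    rw [div_mul_eq_mul_div, le_div_iff₀ (by positivity)]
    linarith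
  calc 1 / (Real.pi * R' ^ 2) * supBallIntegral φ R'
      ≤ 1 / (Real.pi * R' ^ 2) * ((R + R') ^ 2 / R ^ 2 * supBallIntegral φ R) := by gcongr
    _ = _ := by field_simp; ring

/-- The limit is the infimum of the averages: for fixed `R`, the factor `(1 + R/R')²` tends to 1, so
the upper limit is at most the average at `R`. -/
theorem exists_tendsto_average (hφ : Continuous φ) (h0 : ∀ z, 0 ≤ φ z) (h1 : ∀ z, φ z ≤ K) :
    ∃ l, Tendsto (fun R : ℝ => 1 / (Real.pi * R ^ 2) * supBallIntegral φ R) atTop (𝓝 l) := by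
  set m := fun R : ℝ => 1 / (Real.pi * R ^ 2) * supBallIntegral φ R with hm
  have hm0 : ∀ R, 0 ≤ m R := fun R =>
    mul_nonneg (by positivity) (supBallIntegral_nonneg h0 R)
  set S := m '' Set.Ioi 0 with hS
  have hbdd : BddBelow S := ⟨0, by rintro _ ⟨R, _, rfl⟩; exact hm0 R⟩
  have hne : S.Nonempty := ⟨m 1, 1, by simp, rfl⟩
  refine ⟨sInf S, tendsto_order.2 ⟨fun c hc => ?_, fun c hc => ?_⟩⟩
  · filter_upwards [eventually_gt_atTop 0] with R hR
    exact hc.trans_le (csInf_le hbdd ⟨R, hR, rfl⟩)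
  · obtain ⟨_, ⟨R, hR, rfl⟩, hRc⟩ := exists_lt_of_csInf_lt hne hc
    have ht : Tendsto (fun R' : ℝ => (1 + R / R') ^ 2 * m R) atTop (𝓝 ((1 + 0) ^ 2 * m R)) :=
      (((tendsto_const_nhds.div_atTop tendsto_id).const_add 1).pow 2).mul_const _
    filter_upwards [ht.eventually_lt_const (by simpa using hRc), eventually_gt_atTop 0]
      with R' h2 h3
    exact (supBallIntegral_averaging hφ h0 h1 hR h3).trans_lt h2

end Averages

theorem IsBrodyCurve.tendsto_meanEnergy {N : ℕ} {f : ℂ → CP N} (hf : IsBrodyCurve f) :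
    Tendsto (meanEnergy f) atTop (𝓝 (energyDensity f)) := by
  obtain ⟨l, hl⟩ := exists_tendsto_average (K := 1) (hf.1.continuous_sphericalDeriv.pow 2)
    (fun z => sq_nonneg _) fun z => pow_le_one₀ (sphericalDeriv_nonneg f z) (hf.2 z)
  have h : Tendsto (meanEnergy f) atTop (𝓝 l) := hl
  rwa [energyDensity, h.limUnder_eq]

theorem energyDensity_ge_of_sq_le {N : ℕ} {f g : ℂ → CP N} (hf : IsBrodyCurve f)
    (hg : IsBrodyCurve g) {ε : ℝ}
    (h : ∀ z, sphericalDeriv f z ^ 2 ≤ sphericalDeriv g z ^ 2 + ε) :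
    energyDensity g ≥ energyDensity f - ε := by
  have hle : ∀ R : ℝ, 0 < R → meanEnergy f R ≤ meanEnergy g R + ε := fun R hR => by
    have hcf : Continuous fun z => sphericalDeriv f z ^ 2 :=
      hf.1.continuous_sphericalDeriv.pow 2
    have hcg : Continuous fun z => sphericalDeriv g z ^ 2 :=
      hg.1.continuous_sphericalDeriv.pow 2
    have key : ⨆ a : ℂ, ∫ z in Metric.ball a R, sphericalDeriv f z ^ 2 ≤
        (⨆ a : ℂ, ∫ z in Metric.ball a R, sphericalDeriv g z ^ 2) + Real.pi * R ^ 2 * ε := by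
      refine ciSup_le fun a => ?_
      have hi : IntegrableOn (fun _ : ℂ => ε) (Metric.ball a R) :=
        integrableOn_ball continuous_const a R
      calc ∫ z in Metric.ball a R, sphericalDeriv f z ^ 2
          ≤ ∫ z in Metric.ball a R, (sphericalDeriv g z ^ 2 + ε) :=
            setIntegral_mono_on (integrableOn_ball hcf a R)
              ((integrableOn_ball hcg a R).add hi) measurableSet_ball fun z _ => h z
        _ = (∫ z in Metric.ball a R, sphericalDeriv g z ^ 2) + Real.pi * R ^ 2 * ε := by
            rw [integral_add (integrableOn_ball hcg a R) hi, setIntegral_const,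
              volume_real_ball a hR.le, smul_eq_mul]
        _ ≤ _ := by
            gcongr
            exact le_ciSup (bddAbove_ballIntegral (K := 1) hcg (fun z =>
              pow_le_one₀ (sphericalDeriv_nonneg g z) (hg.2 z)) hR.le) a
    unfold meanEnergy
    calc _ ≤ 1 / (Real.pi * R ^ 2) * ((⨆ a : ℂ, ∫ z in Metric.ball a R, sphericalDeriv g z ^ 2) +
          Real.pi * R ^ 2 * ε) := by gcongr
      _ = _ := by field_simp
  have := le_of_tendsto_of_tendsto hf.tendsto_meanEnergy (hg.tendsto_meanEnergy.add_const ε)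
    ((eventually_gt_atTop 0).mono hle)
  linarith

/-! ### Sums of fourth-order poles over the Gaussian integers. -/

section Lattice

/-- The Gaussian integer `n₁ + n₂ i` as a complex number. -/
noncomputable def gaussPt (n : ℤ × ℤ) : ℂ := ⟨n.1, n.2⟩

theorem gaussPt_sub (m n : ℤ × ℤ) : gaussPt (m - n) = gaussPt m - gaussPt n := by
  apply Complex.ext <;> simp [gaussPt]

/-- A product weight, so that summability is one-dimensional. It dominates fourth-order decay
because `(1 + a)(1 + b) ≤ (1 + a + b)²`. -/
noncomputable def latticeWeight (n : ℤ × ℤ) : ℝ :=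
  (1 + (n.1 : ℝ) ^ 2)⁻¹ * (1 + (n.2 : ℝ) ^ 2)⁻¹

theorem summable_latticeWeight : Summable latticeWeight := by
  have h : Summable fun n : ℤ => (1 + (n : ℝ) ^ 2)⁻¹ := by
    have h1 : Summable fun n : ℤ => (1 : ℝ) / (n : ℝ) ^ 2 :=
      Real.summable_one_div_int_pow.2 (by norm_num)
    refine h1.of_norm_bounded_eventually ?_
    filter_upwards [(Set.finite_singleton (0 : ℤ)).compl_mem_cofinite] with n hn
    have : (n : ℝ) ≠ 0 := by simpa using hn
    rw [one_div, norm_inv, Real.norm_of_nonneg (by positivity)]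
    gcongr
    linarith
  exact h.mul_of_nonneg h (fun _ => by positivity) fun _ => by positivity

theorem norm_gaussPt_sq (n : ℤ × ℤ) : ‖gaussPt n‖ ^ 2 = (n.1 : ℝ) ^ 2 + (n.2 : ℝ) ^ 2 := by
  rw [← Complex.normSq_eq_norm_sq, Complex.normSq_apply]; simp [gaussPt]; ring

theorem exists_near_gaussPt {M : ℝ} (hM : 0 < M) (z : ℂ) :
    ∃ n : ℤ × ℤ, ‖z - M * gaussPt n‖ ≤ 3 / 4 * M := by
  refine ⟨(round (z.re / M), round (z.im / M)), ?_⟩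
  have h : ∀ x : ℝ, (x - M * round (x / M)) ^ 2 ≤ M ^ 2 / 4 := fun x => by
    have h1 := abs_sub_round (x / M)
    have h2 : x - M * round (x / M) = M * (x / M - round (x / M)) := by field_simp
    rw [h2, mul_pow, ← sq_abs (x / M - _)]
    nlinarith [abs_nonneg (x / M - round (x / M)), sq_nonneg M,
      mul_le_mul h1 h1 (abs_nonneg _) (by norm_num)]
  refine abs_le_of_sq_le_sq' ?_ (by positivity) |>.2
  rw [← Complex.normSq_eq_norm_sq, Complex.normSq_apply]
  simp [gaussPt]
  nlinarith [h z.re, h z.im, sq_nonneg M]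

theorem norm_pole_le {M r : ℝ} (hM : 0 < M) {w : ℂ} {n₀ n : ℤ × ℤ}
    (h0 : ‖w - M * gaussPt n₀‖ ≤ M) (h1 : M / 4 ≤ ‖w - M * gaussPt n‖) :
    ‖((r / (w - M * gaussPt n)) ^ 4 : ℂ)‖ ≤ 1681 * (r / M) ^ 4 * latticeWeight (n - n₀) := by
  set t := ‖w - M * gaussPt n‖ with ht
  have h2 : M * ‖gaussPt (n - n₀)‖ ≤ 5 * t := by
    have : (M * gaussPt (n - n₀) : ℂ) = (w - M * gaussPt n₀) - (w - M * gaussPt n) := by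
      rw [gaussPt_sub]; ring
    calc M * ‖gaussPt (n - n₀)‖ = ‖(M * gaussPt (n - n₀) : ℂ)‖ := by
          rw [norm_mul, Complex.norm_real, Real.norm_of_nonneg hM.le]
      _ ≤ M + t := by rw [this]; exact (norm_sub_le _ _).trans (by gcongr)
      _ ≤ 5 * t := by linarith
  have ht0 : 0 < t := by linarith
  -- `41 = 4² + 5²`, from `M ≤ 4t` and `h2`; then `1681 = 41²`.
  have h3 : M ^ 2 * (1 + ‖gaussPt (n - n₀)‖ ^ 2) ≤ 41 * t ^ 2 := by
    have := norm_nonneg (gaussPt (n - n₀))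
    nlinarith [mul_self_le_mul_self (by positivity) h2, mul_self_le_mul_self (by positivity) h1]
  set a := ((n - n₀).1 : ℝ) ^ 2 with ha
  set b := ((n - n₀).2 : ℝ) ^ 2 with hb
  have ha0 : 0 ≤ a := sq_nonneg _
  have hb0 : 0 ≤ b := sq_nonneg _
  rw [norm_gaussPt_sq, ← ha, ← hb] at h3
  have h4 : M ^ 4 * ((1 + a) * (1 + b)) ≤ 1681 * t ^ 4 := by
    calc M ^ 4 * ((1 + a) * (1 + b)) ≤ M ^ 4 * ((1 + (a + b)) * (1 + (a + b))) := by
          gcongr <;> linarith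
      _ = (M ^ 2 * (1 + (a + b))) ^ 2 := by ring
      _ ≤ (41 * t ^ 2) ^ 2 := by gcongr
      _ = _ := by ring
  rw [norm_pow, norm_div, ← ht, Complex.norm_real, Real.norm_eq_abs, div_pow, Even.pow_abs (by decide),
    latticeWeight, ← ha, ← hb, div_pow, div_le_iff₀ (by positivity), ← mul_inv]
  have h5 : 1 ≤ 1681 * t ^ 4 / (M ^ 4 * ((1 + a) * (1 + b))) := by
    rwa [le_div_iff₀ (by positivity), one_mul]
  calc r ^ 4 = r ^ 4 * 1 := by ring
    _ ≤ r ^ 4 * (1681 * t ^ 4 / (M ^ 4 * ((1 + a) * (1 + b)))) := by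
      gcongr
    _ = _ := by field_simp

variable {V : Type*} [NormedAddCommGroup V] [NormedSpace ℂ V]

/-- The sum of the polar parts `(r / (z - M n))⁴ Bₙ` over the Gaussian integers `n`. -/
noncomputable def poleSum (M r : ℝ) (B : ℤ × ℤ → V) (z : ℂ) : V :=
  ∑' n, ((r / (z - M * gaussPt n)) ^ 4 : ℂ) • B n

noncomputable def poleSumConst : ℝ := 1681 * ∑' n, latticeWeight n

theorem poleSumConst_nonneg : 0 ≤ poleSumConst :=
  mul_nonneg (by norm_num) (tsum_nonneg fun n => by unfold latticeWeight; positivity)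

variable {M r : ℝ} {B : ℤ × ℤ → V} {z : ℂ}

/-- A majorant uniform on a disk of radius 2 gives holomorphy and, by Cauchy, the bound on the
derivative. `M ≥ 8` ensures `M/2 - 2 ≥ M/4` and `3M/4 + 2 ≤ M`. The weights are centred at a lattice
point near `z`, but their sum is translation invariant. -/
theorem exists_summable_bound (hM : 8 ≤ M) (hB : ∀ n, ‖B n‖ ≤ 1)
    (hz : ∀ n, B n ≠ 0 → M / 2 ≤ ‖z - M * gaussPt n‖) :
    ∃ u : ℤ × ℤ → ℝ, Summable u ∧ ∑' n, u n = poleSumConst * (r / M) ^ 4 ∧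
      ∀ n, ∀ w ∈ Metric.ball z 2, ‖((r / (w - M * gaussPt n)) ^ 4 : ℂ) • B n‖ ≤ u n := by
  obtain ⟨n₀, hn₀⟩ := exists_near_gaussPt (by linarith : 0 < M) z
  refine ⟨fun n => 1681 * (r / M) ^ 4 * latticeWeight (n - n₀), ?_, ?_, fun n w hw => ?_⟩
  · exact ((Equiv.subRight n₀).summable_iff.2 summable_latticeWeight).mul_left _
  · have := (Equiv.subRight n₀).tsum_eq latticeWeight
    simp only [Equiv.subRight_apply] at this
    rw [tsum_mul_left, this, poleSumConst]
    ring
  · rw [mem_ball_iff_norm] at hw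
    by_cases hn : B n = 0
    · rw [hn, smul_zero, norm_zero]
      unfold latticeWeight; positivity
    · have h1 : M / 4 ≤ ‖w - M * gaussPt n‖ := by
        have := norm_sub_norm_le (z - M * gaussPt n) (z - w)
        rw [sub_sub_sub_cancel_left, norm_sub_rev z w] at this
        linarith [hz n hn]
      have h0 : ‖w - M * gaussPt n₀‖ ≤ M := by
        have := norm_add_le (w - z) (z - M * gaussPt n₀)
        rw [sub_add_sub_cancel] at this
        linarith
      rw [norm_smul]
      refine (mul_le_of_le_one_right (norm_nonneg _) (hB n)).trans
        (norm_pole_le (by linarith) h0 h1)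

theorem norm_poleSum_le (hM : 8 ≤ M) (hB : ∀ n, ‖B n‖ ≤ 1)
    (hz : ∀ n, B n ≠ 0 → M / 2 ≤ ‖z - M * gaussPt n‖) {w : ℂ} (hw : w ∈ Metric.ball z 2) :
    ‖poleSum M r B w‖ ≤ poleSumConst * (r / M) ^ 4 := by
  obtain ⟨u, hu, hu1, hu2⟩ := exists_summable_bound (r := r) hM hB hz
  rw [← hu1]
  exact tsum_of_norm_bounded hu.hasSum fun n => hu2 n w hw

variable [CompleteSpace V]

theorem differentiableOn_poleSum (hM : 8 ≤ M) (hB : ∀ n, ‖B n‖ ≤ 1)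
    (hz : ∀ n, B n ≠ 0 → M / 2 ≤ ‖z - M * gaussPt n‖) :
    DifferentiableOn ℂ (poleSum M r B) (Metric.ball z 2) := by
  obtain ⟨u, hu, -, hu2⟩ := exists_summable_bound (r := r) hM hB hz
  refine Complex.differentiableOn_tsum_of_summable_norm hu (fun n => ?_) Metric.isOpen_ball hu2
  by_cases hn : B n = 0
  · simp [hn]
  · refine DifferentiableOn.smul_const (DifferentiableOn.pow ?_ 4) _
    refine (differentiableOn_const _).div (by fun_prop) fun w hw => ?_
    rw [mem_ball_iff_norm] at hw
    have := norm_sub_norm_le (z - M * gaussPt n) (z - w)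
    rw [sub_sub_sub_cancel_left, norm_sub_rev z w] at this
    exact norm_pos_iff.1 (by linarith [hz n hn])

theorem analyticAt_poleSum (hM : 8 ≤ M) (hB : ∀ n, ‖B n‖ ≤ 1)
    (hz : ∀ n, B n ≠ 0 → M / 2 ≤ ‖z - M * gaussPt n‖) : AnalyticAt ℂ (poleSum M r B) z :=
  (differentiableOn_poleSum hM hB hz).analyticAt (Metric.ball_mem_nhds z (by norm_num))

theorem norm_deriv_poleSum_le (hM : 8 ≤ M) (hB : ∀ n, ‖B n‖ ≤ 1)
    (hz : ∀ n, B n ≠ 0 → M / 2 ≤ ‖z - M * gaussPt n‖) :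
    ‖deriv (poleSum M r B) z‖ ≤ poleSumConst * (r / M) ^ 4 := by
  have h := Complex.norm_deriv_le_of_forall_mem_sphere_norm_le (c := z) (R := 1)
    (f := poleSum M r B) one_pos
    ((differentiableOn_poleSum hM hB hz).mono (by
      rw [closure_ball z one_ne_zero]
      exact Metric.closedBall_subset_ball (by norm_num))).diffContOnCl
    fun w hw => norm_poleSum_le (r := r) hM hB hz
      (Metric.sphere_subset_closedBall.trans (Metric.closedBall_subset_ball (by norm_num)) hw)
  simpa using h

theorem poleSum_eq_add [DecidableEq (ℤ × ℤ)] (hM : 8 ≤ M) (hB : ∀ n, ‖B n‖ ≤ 1) {b : ℤ × ℤ}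
    (hz : ∀ n, n ≠ b → B n ≠ 0 → M / 2 ≤ ‖z - M * gaussPt n‖) {w : ℂ}
    (hw : w ∈ Metric.ball z 2) :
    poleSum M r B w = ((r / (w - M * gaussPt b)) ^ 4 : ℂ) • B b +
      poleSum M r (Function.update B b 0) w := by
  obtain ⟨u, hu, -, hu2⟩ := exists_summable_bound (z := z) (r := r)
    (B := Function.update B b 0) hM (fun n => by
      rcases eq_or_ne n b with rfl | h <;> simp [*]) fun n hn => by
      rcases eq_or_ne n b with rfl | h
      · simp at hn
      · exact hz n h (by simpa [h] using hn)
  have hs : Summable fun n => ((r / (w - M * gaussPt n)) ^ 4 : ℂ) • Function.update B b 0 n :=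
    .of_norm_bounded hu fun n => hu2 n w hw
  have e : ∀ n, Function.update (fun n => ((r / (w - M * gaussPt n)) ^ 4 : ℂ) • B n) b 0 n =
      ((r / (w - M * gaussPt n)) ^ 4 : ℂ) • Function.update B b 0 n := fun n => by
    rcases eq_or_ne n b with rfl | h <;> simp [*]
  rw [poleSum, Summable.tsum_eq_add_tsum_ite' b (hs.congr fun n => (e n).symm), poleSum]
  congr 1
  refine tsum_congr fun n => ?_
  rw [← e, Function.update_apply]

end Lattice

/-! ### Linear algebra: small perturbations and the model bubble `v + h u`. -/

section Perturbation

variable {E : Type*} [NormedAddCommGroup E] [InnerProductSpace ℂ E]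

theorem add_apply_ne_zero {T : E →L[ℂ] E} {η : ℝ} (hη : η ≤ 1 / 2) (hT : ‖T‖ ≤ η) {x : E}
    (hx : x ≠ 0) : x + T x ≠ 0 := by
  intro h
  have h1 := norm_sub_norm_le x (-(T x))
  rw [sub_neg_eq_add, h, norm_neg, norm_zero] at h1
  have := T.le_of_opNorm_le hT x
  nlinarith [norm_pos_iff.2 hx]

/-- The vector `y + (T' x + T y)` is the derivative of `(1 + T)F` when `F = x` and `F' = y`. For
every `c` the distance to the line changes by at most `η‖y - c x‖ + η‖x‖`. With `fsDeriv ≤ 2` and `1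
- η ≥ 1/2`, the increase is at most `(2·2 + 1)η/(1/2) = 10η`. -/
theorem abs_fsDeriv_perturb_sub_le {T T' : E →L[ℂ] E} {η : ℝ} (hη : η ≤ 1 / 2) (hT : ‖T‖ ≤ η)
    (hT' : ‖T'‖ ≤ η) {x y : E} (hx : x ≠ 0) (hD : fsDeriv x y ≤ 2) :
    |fsDeriv (x + T x) (y + (T' x + T y)) - fsDeriv x y| ≤ 10 * η := by
  have hη0 : 0 ≤ η := (norm_nonneg T).trans hT
  have hD0 := fsDeriv_nonneg x y
  have hx0 : 0 < ‖x‖ := norm_pos_iff.2 hx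
  have hG := add_apply_ne_zero hη hT hx
  have hdiff : ∀ c : ℂ, y + (T' x + T y) - c • (x + T x) = (y - c • x) + (T (y - c • x) + T' x) :=
    fun c => by rw [map_sub, map_smul, smul_add]; abel
  have hpert : ∀ c : ℂ, ‖T (y - c • x) + T' x‖ ≤ η * ‖y - c • x‖ + η * ‖x‖ := fun c =>
    (norm_add_le _ _).trans (add_le_add (T.le_of_opNorm_le hT _) (T'.le_of_opNorm_le hT' _))
  have hTx := T.le_of_opNorm_le hT x
  refine abs_sub_le_iff.2 ⟨?_, ?_⟩
  · obtain ⟨c, -, hc⟩ := exists_fsDeriv_eq hx y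
    have h1 := fsDeriv_le hG (y + (T' x + T y)) c
    have h2 : (1 - η) * ‖x‖ ≤ ‖x + T x‖ := by
      have := norm_sub_norm_le x (-(T x))
      rw [sub_neg_eq_add, norm_neg] at this
      linarith
    rw [le_div_iff₀ (norm_pos_iff.2 hG), hdiff] at h1
    have h3 := (norm_add_le (y - c • x) (T (y - c • x) + T' x)).trans
      (add_le_add_right (hpert c) _)
    rw [hc] at h3
    set D' := fsDeriv (x + T x) (y + (T' x + T y))
    have hD'0 : 0 ≤ D' := fsDeriv_nonneg _ _
    have h4 : D' * ((1 - η) * ‖x‖) ≤ ((1 + η) * fsDeriv x y + η) * ‖x‖ := by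
      calc _ ≤ D' * ‖x + T x‖ := by gcongr
        _ ≤ _ := h1.trans (h3.trans (le_of_eq (by ring)))
    rw [← mul_assoc] at h4
    have h5 := le_of_mul_le_mul_right h4 hx0
    nlinarith
  · have h2 : ‖x + T x‖ ≤ (1 + η) * ‖x‖ := (norm_add_le _ _).trans (by linarith)
    have h1 : fsDeriv x y - 10 * η ≤ fsDeriv (x + T x) (y + (T' x + T y)) := by
      refine le_fsDeriv hG fun c => ?_
      rw [hdiff]
      have h3 := norm_sub_norm_le (y - c • x) (-(T (y - c • x) + T' x))
      rw [sub_neg_eq_add, norm_neg] at h3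
      have h4 := hpert c
      have h5 := fsDeriv_le hx y c
      rw [le_div_iff₀ hx0] at h5
      rcases le_total (fsDeriv x y - 10 * η) 0 with h6 | h6
      · exact (mul_nonpos_of_nonpos_of_nonneg h6 (norm_nonneg _)).trans (norm_nonneg _)
      · calc _ ≤ (fsDeriv x y - 10 * η) * ((1 + η) * ‖x‖) := by gcongr
          _ ≤ (1 - η) * (fsDeriv x y * ‖x‖) - η * ‖x‖ := by
            have : (fsDeriv x y - 10 * η) * (1 + η) ≤ (1 - η) * fsDeriv x y - η := by nlinarith
            nlinarith
          _ ≤ (1 - η) * ‖y - c • x‖ - η * ‖x‖ := by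
            gcongr
            linarith
          _ ≤ _ := by linarith
    linarith

variable {v u p q : E} {h h' : ℂ} {σ : ℝ}

theorem norm_add_smul_sq (hv : ‖v‖ = 1) (hu : ‖u‖ = 1) (hvu : inner ℂ v u = 0) (a b : ℂ) :
    ‖a • v + b • u‖ ^ 2 = ‖a‖ ^ 2 + ‖b‖ ^ 2 := by
  have := norm_add_sq_eq_norm_sq_add_norm_sq_of_inner_eq_zero (a • v) (b • u)
    (by rw [inner_smul_left, inner_smul_right, hvu]; simp)
  simp only [norm_smul, hv, hu, mul_one] at this
  nlinarith

theorem one_le_norm_bubble (hv : ‖v‖ = 1) (hu : ‖u‖ = 1) (hvu : inner ℂ v u = 0) (h : ℂ) :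
    1 ≤ ‖v + h • u‖ := by
  have := norm_add_smul_sq hv hu hvu 1 h
  rw [one_smul, norm_one] at this
  nlinarith [norm_nonneg (v + h • u), sq_nonneg ‖h‖]

theorem bubble_ne_zero (hv : ‖v‖ = 1) (hu : ‖u‖ = 1) (hvu : inner ℂ v u = 0)
    (hq : ‖q‖ ≤ 3 / 20) : v + h • u + q ≠ 0 := by
  intro h0
  have h1 := norm_sub_norm_le (v + h • u) (-q)
  rw [sub_neg_eq_add, h0, norm_neg, norm_zero] at h1
  linarith [one_le_norm_bubble hv hu hvu h]

theorem fsDeriv_bubble_le (hv : ‖v‖ = 1) (hu : ‖u‖ = 1) (hvu : inner ℂ v u = 0)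
    (hq : ‖q‖ ≤ 3 / 20) (hp : ‖p‖ ≤ σ) {k : ℝ} (hk : ‖h'‖ ≤ k * (1 + ‖h‖ ^ 2)) :
    fsDeriv (v + h • u + q) (h' • u + p) ≤ 2 * k + 2 * σ := by
  have hσ : 0 ≤ σ := (norm_nonneg p).trans hp
  set n := ‖v + h • u‖ with hn
  have hn1 : 1 ≤ n := one_le_norm_bubble hv hu hvu h
  have hn2 : n ^ 2 = 1 + ‖h‖ ^ 2 := by
    simpa using norm_add_smul_sq hv hu hvu 1 h
  have hk0 : 0 ≤ k := by
    by_contra! hneg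
    nlinarith [norm_nonneg h', sq_nonneg ‖h‖]
  have hG := bubble_ne_zero (h := h) hv hu hvu hq
  have hGn : 17 / 20 * n ≤ ‖v + h • u + q‖ := by
    have h1 := norm_sub_norm_le (v + h • u) (-q)
    rw [sub_neg_eq_add, norm_neg] at h1
    linarith
  -- The coefficient of the projection of `h' u` onto `v + h u`; the remainder has length `‖h'‖/n`.
  set l : ℂ := h' * (starRingEnd ℂ) h / (n ^ 2 : ℝ) with hl
  have hn0 : ((n ^ 2 : ℝ) : ℂ) ≠ 0 := by
    rw [Complex.ofReal_ne_zero]; positivity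
  have hhn : ‖h‖ ≤ n := by nlinarith [norm_nonneg h]
  have hln : ‖l‖ ≤ k * n := by
    rw [hl, norm_div, norm_mul, RCLike.norm_conj, Complex.norm_real, Real.norm_of_nonneg (by positivity),
      div_le_iff₀ (by positivity)]
    calc ‖h'‖ * ‖h‖ ≤ (k * (1 + ‖h‖ ^ 2)) * n := by gcongr
      _ = _ := by rw [← hn2]; ring
  have hmain : h' • u - l • (v + h • u) =
      (-(h' * (starRingEnd ℂ) h / (n ^ 2 : ℝ))) • v + (h' / (n ^ 2 : ℝ)) • u := by
    have e : h' - l * h = h' / (n ^ 2 : ℝ) := by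
      rw [hl]
      field_simp
      have h1 : h * (starRingEnd ℂ) h = ((‖h‖ ^ 2 : ℝ) : ℂ) := by
        rw [Complex.mul_conj, Complex.normSq_eq_norm_sq]
      rw [hn2]
      push_cast at h1 ⊢
      linear_combination (-h') * h1
    rw [← e, ← hl, smul_add, sub_smul, neg_smul, smul_smul]
    abel
  have hmn : ‖h' • u - l • (v + h • u)‖ ≤ k * n := by
    have h1 := norm_add_smul_sq hv hu hvu (-(h' * (starRingEnd ℂ) h / (n ^ 2 : ℝ)))
      (h' / (n ^ 2 : ℝ))
    rw [← hmain, norm_neg, norm_div, norm_mul, RCLike.norm_conj, norm_div, Complex.norm_real,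
      Real.norm_of_nonneg (by positivity : (0 : ℝ) ≤ n ^ 2)] at h1
    have h2 : (‖h'‖ * ‖h‖ / n ^ 2) ^ 2 + (‖h'‖ / n ^ 2) ^ 2 = (‖h'‖ / n) ^ 2 := by
      field_simp
      linear_combination (-‖h'‖ ^ 2) * hn2
    rw [h2] at h1
    have h3 : ‖h' • u - l • (v + h • u)‖ = ‖h'‖ / n :=
      (pow_left_inj₀ (norm_nonneg _) (by positivity) two_ne_zero).1 h1
    rw [h3, div_le_iff₀ (by positivity)]
    rw [← hn2] at hk
    linarith
  have hX : ‖h' • u + p - l • (v + h • u + q)‖ ≤ k * n + σ + k * n * (3 / 20) := by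
    have : h' • u + p - l • (v + h • u + q) = (h' • u - l • (v + h • u)) + p - l • q := by
      rw [smul_add l _ q]; abel
    rw [this]
    refine (norm_sub_le _ _).trans (add_le_add ((norm_add_le _ _).trans (add_le_add hmn hp)) ?_)
    rw [norm_smul]
    gcongr
  refine (fsDeriv_le hG _ l).trans ?_
  rw [div_le_iff₀ (norm_pos_iff.2 hG)]
  calc _ ≤ k * n + σ + k * n * (3 / 20) := hX
    _ ≤ (2 * k + 2 * σ) * (17 / 20 * n) := by nlinarith [mul_nonneg hk0 (zero_le_one.trans hn1)]
    _ ≤ _ := by gcongr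

/-- Pairing with `v` shows that a large multiplier `l` is costly, pairing with `u` that a small one
leaves most of `h'`. Weighting the two bounds by 23 and 17 eliminates `‖l‖`. -/
theorem le_fsDeriv_bubble (hv : ‖v‖ = 1) (hu : ‖u‖ = 1) (hvu : inner ℂ v u = 0)
    (hq : ‖q‖ ≤ 3 / 20) (hp : ‖p‖ ≤ σ) (hh : ‖h‖ = 1) :
    ‖h'‖ / 6 - σ ≤ fsDeriv (v + h • u + q) (h' • u + p) := by
  have huv : inner ℂ u v = 0 := inner_eq_zero_symm.1 hvu
  have hσ : 0 ≤ σ := (norm_nonneg p).trans hp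
  refine le_fsDeriv (bubble_ne_zero hv hu hvu hq) fun l => ?_
  set X := ‖h' • u + p - l • (v + h • u + q)‖ with hX
  have hX0 : 0 ≤ X := norm_nonneg _
  have hin : ∀ {a : E}, ‖a‖ = 1 → ∀ b : E, ‖inner ℂ a b‖ ≤ ‖b‖ := fun {a} ha b => by
    simpa [ha] using norm_inner_le_norm (𝕜 := ℂ) a b
  have hvv : inner ℂ v v = (1 : ℂ) := by rw [inner_self_eq_norm_sq_to_K, hv]; simp
  have huu : inner ℂ u u = (1 : ℂ) := by rw [inner_self_eq_norm_sq_to_K, hu]; simp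
  have e1 : inner ℂ v (h' • u + p - l • (v + h • u + q)) =
      inner ℂ v p - l * inner ℂ v q - l := by
    simp only [inner_sub_right, inner_add_right, inner_smul_right, hvu, hvv]
    ring
  have e2 : inner ℂ u (h' • u + p - l • (v + h • u + q)) =
      h' - (l * h + l * inner ℂ u q - inner ℂ u p) := by
    simp only [inner_sub_right, inner_add_right, inner_smul_right, huv, huu]
    ring
  have hlq : ∀ {a : E}, ‖a‖ = 1 → ‖l * inner ℂ a q‖ ≤ ‖l‖ * (3 / 20) := fun ha => by
    rw [norm_mul]
    gcongr
    exact (hin ha q).trans hq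
  have b1 : ‖l‖ - (σ + ‖l‖ * (3 / 20)) ≤ X := by
    have h1 := hin hv (h' • u + p - l • (v + h • u + q))
    rw [e1] at h1
    have h2 := norm_sub_norm_le l (inner ℂ v p - l * inner ℂ v q)
    rw [norm_sub_rev l] at h2
    have h3 := norm_sub_le (inner ℂ v p) (l * inner ℂ v q)
    linarith [hin hv p, hlq hv]
  have b2 : ‖h'‖ - (‖l‖ + ‖l‖ * (3 / 20) + σ) ≤ X := by
    have h1 := hin hu (h' • u + p - l • (v + h • u + q))
    rw [e2] at h1
    have h2 := norm_sub_norm_le h' (l * h + l * inner ℂ u q - inner ℂ u p)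
    have h3 := norm_sub_le (l * h + l * inner ℂ u q) (inner ℂ u p)
    have h4 := norm_add_le (l * h) (l * inner ℂ u q)
    rw [norm_mul, hh, mul_one] at h4
    linarith [hin hu p, hlq hu]
  have hG : ‖v + h • u + q‖ ≤ 43 / 20 := by
    refine (norm_add₃_le).trans ?_
    rw [norm_smul, hh, hv, hu]
    linarith
  rcases le_total (‖h'‖ / 6 - σ) 0 with h6 | h6
  · exact (mul_nonpos_of_nonpos_of_nonneg h6 (norm_nonneg _)).trans hX0
  · calc _ ≤ (‖h'‖ / 6 - σ) * (43 / 20) := by gcongr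
      _ ≤ X := by linarith

theorem norm_le_of_fsDeriv_le (hv : ‖v‖ = 1) {x y : E} (hvx : inner ℂ v x = 1)
    (hvy : inner ℂ v y = 0) (hx : ‖x‖ ≤ 11 / 10) {d : ℝ} (hd : fsDeriv x y ≤ d) :
    ‖y‖ ≤ 3 * d := by
  have hx0 : x ≠ 0 := by rintro rfl; simp at hvx
  have hd0 : 0 ≤ d := (fsDeriv_nonneg x y).trans hd
  obtain ⟨c, -, hc⟩ := exists_fsDeriv_eq hx0 y
  have h1 : ‖y - c • x‖ ≤ d * (11 / 10) := by rw [hc]; gcongr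
  have h2 : ‖c‖ ≤ d * (11 / 10) := by
    have := norm_inner_le_norm (𝕜 := ℂ) v (y - c • x)
    rw [inner_sub_right, inner_smul_right, hvx, hvy, hv] at this
    simp only [mul_one, zero_sub, norm_neg, one_mul] at this
    linarith
  calc ‖y‖ = ‖(y - c • x) + c • x‖ := by rw [sub_add_cancel]
    _ ≤ ‖y - c • x‖ + ‖c‖ * ‖x‖ := by rw [← norm_smul]; exact norm_add_le _ _
    _ ≤ d * (11 / 10) + d * (11 / 10) * (11 / 10) := by gcongr
    _ ≤ 3 * d := by linarith

theorem norm_sub_le_of_inner_eq_one (hv : ‖v‖ = 1) {x : E} (hvx : inner ℂ v x = 1)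
    (hx : ‖x‖ ^ 2 ≤ 101 / 100) : ‖x - v‖ ≤ 1 / 10 := by
  have h0 : inner ℂ v (x - v) = 0 := by
    rw [inner_sub_right, hvx, inner_self_eq_norm_sq_to_K, hv]; simp
  have := norm_add_sq_eq_norm_sq_add_norm_sq_of_inner_eq_zero _ _ h0
  rw [add_sub_cancel, hv] at this
  refine abs_le_of_sq_le_sq' ?_ (by norm_num) |>.2
  nlinarith

variable {T T' : E →L[ℂ] E} {η d : ℝ} {x y : E}

/-- Near a pole the glued curve is, up to a homogeneous rescaling, a small perturbation of
the rational curve `v + h u`. -/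
theorem exists_bubble_form (hv : ‖v‖ = 1)
    (hx : ‖x‖ ^ 2 ≤ 101 / 100 * ‖inner ℂ v x‖ ^ 2) (hx0 : x ≠ 0) (hd : fsDeriv x y ≤ d)
    (hd1 : d ≤ 1 / 10) (hη : η ≤ 1 / 25) (hT : ‖T‖ ≤ η) (hT' : ‖T'‖ ≤ η) (h h' : ℂ) :
    ∃ (p q : E) (s c : ℂ), s ≠ 0 ∧ ‖q‖ ≤ 3 / 20 ∧ ‖p‖ ≤ 2 * η + 4 * d ∧
      x + (h * inner ℂ v x) • u + T x = s • (v + h • u + q) ∧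
      y + (h' * inner ℂ v x + h * inner ℂ v y) • u + (T' x + T y) =
        s • (h' • u + p - c • (v + h • u + q)) := by
  set s := inner ℂ v x with hs
  have hs0 : s ≠ 0 := by
    intro h0
    rw [h0, norm_zero] at hx
    nlinarith [norm_pos_iff.2 hx0]
  have hsn : 0 < ‖s‖ := norm_pos_iff.2 hs0
  -- Pass to the affine chart `⟨v, ·⟩ = 1`. By the quotient rule, `y₁` below is the derivative of
  -- the curve there; it is orthogonal to `v`, hence controlled by `fsDeriv`.
  set x₁ := s⁻¹ • x with hx₁
  set t := inner ℂ v y with ht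
  set y₁ := s⁻¹ • y - (t / s) • x₁ with hy₁
  have ex : x = s • x₁ := by rw [hx₁, smul_smul, mul_inv_cancel₀ hs0, one_smul]
  have ey : y = s • (y₁ + (t / s) • x₁) := by
    rw [hy₁, sub_add_cancel, smul_smul, mul_inv_cancel₀ hs0, one_smul]
  have hvx : inner ℂ v x₁ = 1 := by rw [hx₁, inner_smul_right, ← hs, inv_mul_cancel₀ hs0]
  have hvy : inner ℂ v y₁ = 0 := by
    rw [hy₁, inner_sub_right, inner_smul_right, inner_smul_right, hvx, ← ht]
    field_simp
    ring
  have hx₁n : ‖x₁‖ ^ 2 ≤ 101 / 100 := by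
    rw [hx₁, norm_smul, norm_inv, mul_pow, inv_pow, inv_mul_le_iff₀ (by positivity)]
    linarith
  have hx₁n' : ‖x₁‖ ≤ 11 / 10 := by nlinarith [norm_nonneg x₁]
  have hx₁0 : x₁ ≠ 0 := smul_ne_zero (inv_ne_zero hs0) hx0
  have hdy : fsDeriv x₁ y₁ ≤ d := by
    rw [hy₁, fsDeriv_sub_smul hx₁0, hx₁, fsDeriv_smul _ _ (inv_ne_zero hs0)]
    exact hd
  have hyn := norm_le_of_fsDeriv_le hv hvx hvy hx₁n' hdy
  have hη0 : 0 ≤ η := (norm_nonneg T).trans hT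
  have hd0 : 0 ≤ d := (fsDeriv_nonneg x y).trans hd
  have bT : ‖T x₁‖ ≤ η * (11 / 10) := (T.le_of_opNorm_le hT _).trans (by gcongr)
  have bT' : ‖T' x₁‖ ≤ η * (11 / 10) := (T'.le_of_opNorm_le hT' _).trans (by gcongr)
  have bTy : ‖T y₁‖ ≤ η * (3 * d) := (T.le_of_opNorm_le hT _).trans (by gcongr)
  refine ⟨y₁ + T' x₁ + T y₁, (x₁ - v) + T x₁, s, -(t / s), hs0, ?_, ?_, ?_, ?_⟩
  · have := norm_add_le (x₁ - v) (T x₁)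
    linarith [norm_sub_le_of_inner_eq_one hv hvx hx₁n]
  · have := norm_add₃_le (a := y₁) (b := T' x₁) (c := T y₁)
    nlinarith
  · rw [ex, map_smul]
    simp only [smul_add, smul_sub, smul_smul]
    rw [mul_comm h s]
    abel
  · rw [ex, ey]
    simp only [map_smul, map_add]
    match_scalars <;> field_simp <;> ring

end Perturbation

/-! ### Construction of the glued curve and estimates near and far from the poles. -/

section Gluing

variable {N : ℕ}

theorem exists_unit_orthogonal (hN : 1 ≤ N) (v : EuclideanSpace ℂ (Fin (N + 1))) :
    ∃ u : EuclideanSpace ℂ (Fin (N + 1)), ‖u‖ = 1 ∧ inner ℂ v u = 0 := by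
  have h1 := (Submodule.span ℂ {v}).finrank_add_finrank_orthogonal
  have h2 : Module.finrank ℂ (Submodule.span ℂ {v}) ≤ 1 := by
    simpa using finrank_span_le_card (R := ℂ) {v}
  rw [finrank_euclideanSpace_fin] at h1
  have h3 : 0 < Module.finrank ℂ (Submodule.span ℂ {v})ᗮ := by omega
  obtain ⟨w, hw⟩ := Module.finrank_pos_iff_exists_ne_zero.1 h3
  have hw0 : ‖(w : EuclideanSpace ℂ (Fin (N + 1)))‖ ≠ 0 := by simpa using hw
  refine ⟨((‖(w : EuclideanSpace ℂ (Fin (N + 1)))‖⁻¹ : ℝ) : ℂ) • (w : _), ?_, ?_⟩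
  · rw [norm_smul, Complex.norm_real, norm_inv, norm_norm, inv_mul_cancel₀ hw0]
  · rw [inner_smul_right, Submodule.mem_orthogonal_singleton_iff_inner_right.1 w.2, mul_zero]

/-- Orthonormal pairs of vectors, one for each point of the lattice `M ℤ[i]`; the first vector
spans the line given by `f` at that lattice point. -/
structure LatticeFrame (f : ℂ → CP N) (M : ℝ) where
  v : ℤ × ℤ → EuclideanSpace ℂ (Fin (N + 1))
  u : ℤ × ℤ → EuclideanSpace ℂ (Fin (N + 1))
  norm_v : ∀ n, ‖v n‖ = 1
  norm_u : ∀ n, ‖u n‖ = 1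
  inner_eq_zero : ∀ n, inner ℂ (v n) (u n) = 0
  cosSq_eq_one : ∀ n, cosSq (v n) (f (M * gaussPt n)) = 1

theorem nonempty_latticeFrame (hN : 1 ≤ N) (f : ℂ → CP N) (M : ℝ) :
    Nonempty (LatticeFrame f M) := by
  have h : ∀ p : CP N, ∃ v : EuclideanSpace ℂ (Fin (N + 1)), ‖v‖ = 1 ∧ cosSq v p = 1 := fun p => by
    have hp : ‖p.rep‖ ≠ 0 := by simpa using p.rep_nonzero
    refine ⟨((‖p.rep‖⁻¹ : ℝ) : ℂ) • p.rep, ?_, ?_⟩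
    · rw [norm_smul, Complex.norm_real, norm_inv, norm_norm, inv_mul_cancel₀ hp]
    · rw [cosSq, inner_smul_left, inner_self_eq_norm_sq_to_K]
      simp
      field_simp
  choose v hv hv' using h
  choose u hu hu' using exists_unit_orthogonal hN
  exact ⟨⟨fun n => v (f (M * gaussPt n)), fun n => u (v (f (M * gaussPt n))), fun n => hv _,
    fun n => hu _, fun n => hu' _, fun n => hv' _⟩⟩

/-- The lattice points around which `f` is almost constant. -/
def flatIndices (f : ℂ → CP N) (M δ : ℝ) : Set (ℤ × ℤ) :=
  {n | ∀ w ∈ Metric.closedBall (M * gaussPt n : ℂ) M, sphericalDeriv f w ≤ δ}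

theorem analyticAt_clm_apply {E : Type*} [NormedAddCommGroup E] [NormedSpace ℂ E]
    [CompleteSpace E] {S : ℂ → E →L[ℂ] E} {F : ℂ → E} {z : ℂ} (hS : AnalyticAt ℂ S z)
    (hF : AnalyticAt ℂ F z) : AnalyticAt ℂ (fun w => S w (F w)) z := by
  rw [Complex.analyticAt_iff_eventually_differentiableAt]
  filter_upwards [hS.eventually_analyticAt, hF.eventually_analyticAt] with w h1 h2
  exact h1.differentiableAt.clm_apply h2.differentiableAt

theorem one_le_norm_gaussPt_sub {m n : ℤ × ℤ} (h : m ≠ n) : 1 ≤ ‖gaussPt m - gaussPt n‖ := by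
  rw [← gaussPt_sub, ← one_le_sq_iff₀ (norm_nonneg _), norm_gaussPt_sq]
  have h1 : (1 : ℤ) ≤ (m - n).1 ^ 2 + (m - n).2 ^ 2 := by
    by_contra! h2
    have h3 : (m - n).1 = 0 := by nlinarith [sq_nonneg (m - n).1, sq_nonneg (m - n).2]
    have h4 : (m - n).2 = 0 := by nlinarith [sq_nonneg (m - n).1, sq_nonneg (m - n).2]
    exact h (sub_eq_zero.1 (Prod.ext h3 h4))
  exact_mod_cast h1

theorem le_norm_mul_gaussPt_sub {M : ℝ} (hM : 0 ≤ M) {m n : ℤ × ℤ} (h : m ≠ n) :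
    M ≤ ‖(M * gaussPt m - M * gaussPt n : ℂ)‖ := by
  rw [← mul_sub, norm_mul, Complex.norm_real, Real.norm_of_nonneg hM]
  exact le_mul_of_one_le_right hM (one_le_norm_gaussPt_sub h)

theorem isClosed_lattice_image {M : ℝ} (hM : 0 < M) (P : Set (ℤ × ℤ)) :
    IsClosed ((fun n => (M * gaussPt n : ℂ)) '' P) := by
  refine Metric.isClosed_of_pairwise_le_dist hM ?_
  rintro _ ⟨m, -, rfl⟩ _ ⟨n, -, rfl⟩ hmn
  rw [dist_eq_norm]
  exact le_norm_mul_gaussPt_sub hM.le fun h => hmn (by rw [h])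

namespace LatticeFrame

variable {f : ℂ → CP N} {M : ℝ} (D : LatticeFrame f M) (P : Set (ℤ × ℤ))

open Classical in
/-- The rank one operator `x ↦ ⟨vₙ, x⟩ uₙ` for `n ∈ P`, and `0` for the other `n`. -/
noncomputable def polar (n : ℤ × ℤ) :
    EuclideanSpace ℂ (Fin (N + 1)) →L[ℂ] EuclideanSpace ℂ (Fin (N + 1)) :=
  if n ∈ P then (innerSL ℂ (D.v n)).smulRight (D.u n) else 0

theorem polar_apply {n : ℤ × ℤ} (hn : n ∈ P) (x : EuclideanSpace ℂ (Fin (N + 1))) :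
    D.polar P n x = inner ℂ (D.v n) x • D.u n := by
  simp [polar, hn]

theorem polar_eq_zero {n : ℤ × ℤ} (hn : n ∉ P) : D.polar P n = 0 := by
  simp [polar, hn]

theorem norm_polar_le (n : ℤ × ℤ) : ‖D.polar P n‖ ≤ 1 := by
  unfold polar
  split_ifs
  · rw [ContinuousLinearMap.norm_smulRight_apply, innerSL_apply_norm, D.norm_v, D.norm_u, one_mul]
  · simp

/-- The meromorphic operator `∑ₙ (100 / (z - M n))⁴ ⟨vₙ, ·⟩ uₙ`, summed over `n ∈ P`. -/
noncomputable def gluing (z : ℂ) :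
    EuclideanSpace ℂ (Fin (N + 1)) →L[ℂ] EuclideanSpace ℂ (Fin (N + 1)) :=
  poleSum M 100 (D.polar P) z

-- The arbitrary choice of `rep` is harmless, as `gluing` is linear and only the line matters. At a
-- pole the operator takes a default value, so the limiting direction `u n` is prescribed.
open Classical in
noncomputable def gluedVector (z : ℂ) : EuclideanSpace ℂ (Fin (N + 1)) :=
  if h : ∃ n ∈ P, (M * gaussPt n : ℂ) = z then D.u h.choose
  else (f z).rep + D.gluing P z (f z).rep

open Classical in
/-- The map `z ↦ [f(z) + ∑ₙ (100 / (z - M n))⁴ ⟨vₙ, f(z)⟩ uₙ]`. -/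
noncomputable def glued (z : ℂ) : CP N :=
  if h : D.gluedVector P z ≠ 0 then Projectivization.mk ℂ (D.gluedVector P z) h else f z

variable {P} {z : ℂ} {F : ℂ → EuclideanSpace ℂ (Fin (N + 1))}

/-- Any lift of `f` may be used. The free scalar `c` serves to clear the denominator near a pole. -/
theorem exists_mk_eq_glued (hz : ∀ n ∈ P, (M * gaussPt n : ℂ) ≠ z)
    {x : EuclideanSpace ℂ (Fin (N + 1))} (hx : x ≠ 0) (hxf : Projectivization.mk ℂ x hx = f z)
    {c : ℂ} (hc : c ≠ 0) (h : x + D.gluing P z x ≠ 0) :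
    ∃ h' : c • (x + D.gluing P z x) ≠ 0, Projectivization.mk ℂ _ h' = D.glued P z := by
  obtain ⟨a, ha⟩ := Projectivization.exists_smul_eq_mk_rep ℂ x hx
  rw [hxf] at ha
  have e : D.gluedVector P z = (a : ℂ) • (x + D.gluing P z x) := by
    rw [gluedVector, dif_neg (by simpa using hz), ← ha, Units.smul_def, map_smul, smul_add]
  have h1 : D.gluedVector P z ≠ 0 := by rw [e]; exact smul_ne_zero a.ne_zero h
  refine ⟨smul_ne_zero hc h, ?_⟩
  rw [glued, dif_pos h1, Projectivization.mk_eq_mk_iff']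
  exact ⟨c * (a : ℂ)⁻¹, by rw [e, smul_smul, inv_mul_cancel_right₀ a.ne_zero]⟩

theorem eventually_not_pole (hM : 0 < M) (hz : ∀ n ∈ P, (M * gaussPt n : ℂ) ≠ z) :
    ∀ᶠ w in 𝓝 z, ∀ n ∈ P, (M * gaussPt n : ℂ) ≠ w := by
  filter_upwards [(isClosed_lattice_image hM P).isOpen_compl.mem_nhds
    (x := z) (by rintro ⟨n, hn, h⟩; exact hz n hn h)] with w hw n hn h
  exact hw ⟨n, hn, h⟩

theorem isLocalLift_glued (hM : 0 < M) (hz : ∀ n ∈ P, (M * gaussPt n : ℂ) ≠ z)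
    (hS : AnalyticAt ℂ (D.gluing P) z) (hF : IsLocalLift f z F)
    (h : F z + D.gluing P z (F z) ≠ 0) :
    IsLocalLift (D.glued P) z fun w => F w + D.gluing P w (F w) := by
  have ha : AnalyticAt ℂ (fun w => F w + D.gluing P w (F w)) z := hF.1.add (analyticAt_clm_apply hS hF.1)
  refine ⟨ha, ?_⟩
  filter_upwards [eventually_not_pole hM hz, hF.2, ha.continuousAt.eventually_ne h]
    with w h1 h2 h3
  obtain ⟨h4, h5⟩ := h2
  simpa using D.exists_mk_eq_glued h1 h4 h5 one_ne_zero h3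

theorem polar_ne_zero {n : ℤ × ℤ} (h : D.polar P n ≠ 0) : n ∈ P := by
  by_contra hn
  exact h (D.polar_eq_zero P hn)

theorem far_estimates (hM : 8 ≤ M) {η : ℝ} (hη : poleSumConst * (100 / M) ^ 4 ≤ η)
    (hη1 : η ≤ 1 / 2) (hz : ∀ n ∈ P, M / 2 ≤ ‖z - M * gaussPt n‖) (hF : IsLocalLift f z F)
    (hf1 : sphericalDeriv f z ≤ 1) :
    IsLocalLift (D.glued P) z (fun w => F w + D.gluing P w (F w)) ∧
      |sphericalDeriv (D.glued P) z - sphericalDeriv f z| ≤ 10 * η := by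
  have hz' : ∀ n, D.polar P n ≠ 0 → M / 2 ≤ ‖z - M * gaussPt n‖ := fun n hn =>
    hz n (D.polar_ne_zero hn)
  have hS : AnalyticAt ℂ (D.gluing P) z := analyticAt_poleSum hM (D.norm_polar_le P) hz'
  have hT : ‖D.gluing P z‖ ≤ η :=
    (norm_poleSum_le hM (D.norm_polar_le P) hz' (Metric.mem_ball_self (by norm_num))).trans hη
  have hT' : ‖deriv (D.gluing P) z‖ ≤ η :=
    (norm_deriv_poleSum_le hM (D.norm_polar_le P) hz').trans hη
  have hlift := D.isLocalLift_glued (by linarith) (fun n hn h => by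
    have := hz n hn
    rw [h, sub_self, norm_zero] at this
    linarith) hS hF (add_apply_ne_zero hη1 hT hF.ne_zero)
  refine ⟨hlift, ?_⟩
  have hd : deriv (fun w => F w + D.gluing P w (F w)) z =
      deriv F z + (deriv (D.gluing P) z (F z) + D.gluing P z (deriv F z)) :=
    (hF.1.differentiableAt.hasDerivAt.add
      (hS.differentiableAt.hasDerivAt.clm_apply hF.1.differentiableAt.hasDerivAt)).deriv
  have hpi : 1 ≤ Real.sqrt Real.pi := Real.one_le_sqrt.2 (by linarith [Real.pi_gt_three])
  have hpi2 : Real.sqrt Real.pi ≤ 2 := Real.sqrt_le_iff.2 ⟨by norm_num, by linarith [Real.pi_le_four]⟩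
  rw [sphericalDeriv_eq_fsDeriv hF, div_le_one (by linarith)] at hf1
  have := abs_fsDeriv_perturb_sub_le hη1 hT hT' hF.ne_zero (hf1.trans hpi2)
  rw [sphericalDeriv_eq_fsDeriv hF, sphericalDeriv_eq_fsDeriv hlift, hd, ← sub_div, abs_div,
    abs_of_nonneg (by linarith : 0 ≤ Real.sqrt Real.pi)]
  exact (div_le_self (abs_nonneg _) hpi).trans this

variable {b : ℤ × ℤ}

open Classical in
/-- The part of the gluing operator that is holomorphic near `M b`. -/
noncomputable def regularPart (D : LatticeFrame f M) (P : Set (ℤ × ℤ)) (b : ℤ × ℤ) (z : ℂ) :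
    EuclideanSpace ℂ (Fin (N + 1)) →L[ℂ] EuclideanSpace ℂ (Fin (N + 1)) :=
  poleSum M 100 (Function.update (D.polar P) b 0) z

theorem far_from_other_poles (hM : 0 ≤ M) (hz : ‖z - M * gaussPt b‖ ≤ M / 2) {n : ℤ × ℤ}
    (hn : n ≠ b) : M / 2 ≤ ‖z - M * gaussPt n‖ := by
  have h1 := le_norm_mul_gaussPt_sub hM hn.symm
  have h2 := norm_sub_le (z - M * gaussPt n) (z - M * gaussPt b)
  rw [sub_sub_sub_cancel_left] at h2
  linarith

theorem gluing_eq_add (hM : 8 ≤ M) (hb : b ∈ P) (hz : ‖z - M * gaussPt b‖ ≤ M / 2) :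
    ∀ᶠ w in 𝓝 z, ∀ x, D.gluing P w x =
      ((100 / (w - M * gaussPt b)) ^ 4 * inner ℂ (D.v b) x) • D.u b + D.regularPart P b w x := by
  classical
  filter_upwards [Metric.ball_mem_nhds z (by norm_num : (0 : ℝ) < 2)] with w hw x
  have h := poleSum_eq_add (r := 100) hM (D.norm_polar_le P)
    (fun n hn _ => far_from_other_poles (by linarith) hz hn) hw
  rw [gluing, h]
  simp only [add_apply, smul_apply,
    D.polar_apply P hb, smul_smul, regularPart]
  congr! 3

theorem regularPart_estimates (hM : 8 ≤ M) {η : ℝ} (hη : poleSumConst * (100 / M) ^ 4 ≤ η)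
    (hz : ‖z - M * gaussPt b‖ ≤ M / 2) :
    AnalyticAt ℂ (D.regularPart P b) z ∧ ‖D.regularPart P b z‖ ≤ η ∧
      ‖deriv (D.regularPart P b) z‖ ≤ η := by
  classical
  have hB : ∀ n, ‖Function.update (D.polar P) b 0 n‖ ≤ 1 := fun n => by
    rcases eq_or_ne n b with rfl | h
    · simp
    · simpa [h] using D.norm_polar_le P n
  have hz' : ∀ n, Function.update (D.polar P) b 0 n ≠ 0 → M / 2 ≤ ‖z - M * gaussPt n‖ :=
    fun n hn => by
      rcases eq_or_ne n b with rfl | h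
      · simp at hn
      · exact far_from_other_poles (by linarith) hz h
  have e : D.regularPart P b = poleSum M 100 (Function.update (D.polar P) b 0) := by
    ext1 w; unfold regularPart; congr!
  rw [e]
  exact ⟨analyticAt_poleSum hM hB hz',
    (norm_poleSum_le hM hB hz' (Metric.mem_ball_self (by norm_num))).trans hη,
    (norm_deriv_poleSum_le hM hB hz').trans hη⟩


/-- On a flat disk `cosSq` moves by at most `2√π · M/(1000M) ≤ 1/250` from its value 1 at the
centre. -/
theorem norm_sq_le_of_flat (hf : IsHolomorphic f) (hM : 8 ≤ M)
    (hb : b ∈ flatIndices f M (1 / (1000 * M))) (hz : ‖z - M * gaussPt b‖ ≤ M)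
    (hF : IsLocalLift f z F) : ‖F z‖ ^ 2 ≤ 101 / 100 * ‖inner ℂ (D.v b) (F z)‖ ^ 2 := by
  have h1 := abs_cosSq_sub_le hf (D.norm_v b) hb (mem_closedBall_iff_norm.2 hz)
  obtain ⟨h0, h2⟩ := hF.2.self_of_nhds
  rw [D.cosSq_eq_one, ← h2, cosSq_mk] at h1
  have hpi2 : Real.sqrt Real.pi ≤ 2 :=
    Real.sqrt_le_iff.2 ⟨by norm_num, by linarith [Real.pi_le_four]⟩
  have h3 : 2 * Real.sqrt Real.pi * (1 / (1000 * M)) * ‖z - M * gaussPt b‖ ≤ 1 / 250 := by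
    calc _ ≤ 2 * 2 * (1 / (1000 * M)) * M := by gcongr
      _ = 1 / 250 := by field_simp; norm_num
  have h4 : 249 / 250 ≤ ‖inner ℂ (D.v b) (F z)‖ ^ 2 / ‖F z‖ ^ 2 := by
    linarith [(abs_le.1 (h1.trans h3)).1]
  rw [le_div_iff₀ (by have := norm_pos_iff.2 h0; positivity)] at h4
  linarith [sq_nonneg ‖F z‖]

theorem near_estimates (hf : IsHolomorphic f) (hM : 8 ≤ M) {η : ℝ}
    (hη : poleSumConst * (100 / M) ^ 4 ≤ η) (hη1 : η ≤ 1 / 10000) (hb : b ∈ P)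
    (hP : P ⊆ flatIndices f M (1 / (1000 * M))) (hz0 : z ≠ M * gaussPt b)
    (hz : ‖z - M * gaussPt b‖ ≤ M / 2) (hF : IsLocalLift f z F) :
    IsLocalLift (D.glued P) z (fun w => F w + D.gluing P w (F w)) ∧
      sphericalDeriv (D.glued P) z ≤ 1 / 10 ∧
      (‖z - M * gaussPt b‖ = 100 → 1 / 400 ≤ sphericalDeriv (D.glued P) z) := by
  have hM0 : 0 < M := by linarith
  obtain ⟨hT, hTη, hTη'⟩ := D.regularPart_estimates (P := P) (b := b) hM hη hz
  have hpi : 1 ≤ Real.sqrt Real.pi := Real.one_le_sqrt.2 (by linarith [Real.pi_gt_three])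
  have hpi2 : Real.sqrt Real.pi ≤ 2 :=
    Real.sqrt_le_iff.2 ⟨by norm_num, by linarith [Real.pi_le_four]⟩
  have hzb : z - M * gaussPt b ≠ 0 := sub_ne_zero.2 hz0
  have hangle := D.norm_sq_le_of_flat hf hM (hP hb) (hz.trans (by linarith)) hF
  have hfd : fsDeriv (F z) (deriv F z) ≤ 1 / 4000 := by
    have h1 := hP hb z (mem_closedBall_iff_norm.2 (hz.trans (by linarith)))
    rw [sphericalDeriv_eq_fsDeriv hF, div_le_iff₀ (by linarith)] at h1
    refine h1.trans ?_
    calc 1 / (1000 * M) * Real.sqrt Real.pi ≤ 1 / (1000 * 8) * 2 := by gcongr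
      _ = _ := by norm_num
  set h : ℂ := (100 / (z - M * gaussPt b)) ^ 4 with hh
  set h' : ℂ := 4 * (100 / (z - M * gaussPt b)) ^ 3 *
    (-100 / (z - M * gaussPt b) ^ 2) with hh'
  have hder : HasDerivAt (fun w : ℂ => (100 / (w - M * gaussPt b)) ^ 4) h' z := by
    have h1 := ((hasDerivAt_const z (100 : ℂ)).div ((hasDerivAt_id z).sub_const (M * gaussPt b))
      hzb).pow 4
    refine h1.congr_deriv ?_
    simp [hh']
  have hFd := hF.1.differentiableAt.hasDerivAt
  have hvF : HasDerivAt (fun w => inner ℂ (D.v b) (F w)) (inner ℂ (D.v b) (deriv F z)) z :=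
    (innerSL ℂ (D.v b)).hasFDerivAt.comp_hasDerivAt z hFd
  obtain ⟨p, q, s, c, hs, hq, hp, e1, e2⟩ := exists_bubble_form (u := D.u b) (D.norm_v b) hangle
    hF.ne_zero hfd (by norm_num) (hη1.trans (by norm_num)) hTη hTη' h h'
  have hev := D.gluing_eq_add hM hb hz
  have hsum : AnalyticAt ℂ (D.gluing P) z := by
    have ha : AnalyticAt ℂ (fun w : ℂ => ((100 / (w - M * gaussPt b)) ^ 4 : ℂ) • D.polar P b +
        D.regularPart P b w) z := by
      refine AnalyticAt.add (AnalyticAt.smul (AnalyticAt.pow (AnalyticAt.div analyticAt_const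
        (analyticAt_id.sub analyticAt_const) hzb) 4) analyticAt_const) hT
    refine ha.congr ?_
    filter_upwards [hev] with w hw
    ext1 x
    rw [hw x]
    simp [D.polar_apply P hb, smul_smul]
  have hval : F z + D.gluing P z (F z) = s • (D.v b + h • D.u b + q) := by
    rw [← e1, hev.self_of_nhds, ← add_assoc]
  have hbub := bubble_ne_zero (h := h) (D.norm_v b) (D.norm_u b) (D.inner_eq_zero b) hq
  have hlift := D.isLocalLift_glued hM0 (fun n hn heq => by
    rcases eq_or_ne n b with rfl | hnb
    · exact hz0 heq.symm
    · have := far_from_other_poles hM0.le hz hnb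
      rw [heq, sub_self, norm_zero] at this
      linarith) hsum hF (by rw [hval]; exact smul_ne_zero hs hbub)
  have hd : deriv (fun w => F w + D.gluing P w (F w)) z =
      s • (h' • D.u b + p - c • (D.v b + h • D.u b + q)) := by
    rw [← e2]
    have h1 : (fun w => F w + D.gluing P w (F w)) =ᶠ[𝓝 z] fun w => F w +
        (((100 / (w - M * gaussPt b)) ^ 4 * inner ℂ (D.v b) (F w)) • D.u b +
          D.regularPart P b w (F w)) := by
      filter_upwards [hev] with w hw
      rw [hw]
    rw [h1.deriv_eq, add_assoc]
    exact (hFd.add (((hder.mul hvF).smul_const (D.u b)).add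
      (hT.differentiableAt.hasDerivAt.clm_apply hFd))).deriv
  have hsph : sphericalDeriv (D.glued P) z =
      fsDeriv (D.v b + h • D.u b + q) (h' • D.u b + p) / Real.sqrt Real.pi := by
    rw [sphericalDeriv_eq_fsDeriv hlift, hd, hval, fsDeriv_smul _ _ hs, fsDeriv_sub_smul hbub]
  have hn0 : 0 < ‖z - M * gaussPt b‖ := norm_pos_iff.2 hzb
  set t : ℝ := 100 / ‖z - M * gaussPt b‖ with ht
  have ht0 : 0 < t := by positivity
  have hhn : ‖h‖ = t ^ 4 := by rw [hh, norm_pow, norm_div, Complex.norm_ofNat]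
  have hhn' : ‖h'‖ = 1 / 25 * t ^ 5 := by
    rw [hh', norm_mul, norm_mul, norm_pow, norm_div, norm_div, norm_neg, norm_pow,
      Complex.norm_ofNat, Complex.norm_ofNat, ht]
    field_simp
    norm_num
  refine ⟨hlift, ?_, fun h100 => ?_⟩
  · have hk : ‖h'‖ ≤ 1 / 25 * (1 + ‖h‖ ^ 2) := by
      rw [hhn, hhn']
      gcongr
      rcases le_total t 1 with h1 | h1
      · exact (pow_le_one₀ ht0.le h1).trans (by nlinarith [sq_nonneg (t ^ 4)])
      · calc t ^ 5 ≤ t ^ 8 := pow_le_pow_right₀ h1 (by norm_num)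
          _ ≤ _ := by nlinarith
    have := fsDeriv_bubble_le (D.norm_v b) (D.norm_u b) (D.inner_eq_zero b) hq hp hk
    rw [hsph]
    refine (div_le_self (fsDeriv_nonneg _ _) hpi).trans ?_
    linarith
  -- On this circle `‖h‖ = 1` and `‖h'‖ = 1/25`, so the bubble's derivative is at least `1/150`
  -- minus a small error, before division by `√π ≤ 2`.
  · have ht1 : t = 1 := by rw [ht, h100]; norm_num
    have := le_fsDeriv_bubble (h' := h') (D.norm_v b) (D.norm_u b) (D.inner_eq_zero b) hq hp
      (by rw [hhn, ht1, one_pow])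
    rw [hhn', ht1] at this
    rw [hsph, le_div_iff₀ (by linarith)]
    linarith

theorem exists_isLocalLift_glued_pole (hf : IsHolomorphic f) (hM : 8 ≤ M) (hb : b ∈ P)
    (hP : P ⊆ flatIndices f M (1 / (1000 * M))) :
    ∃ G, IsLocalLift (D.glued P) (M * gaussPt b) G := by
  have hM0 : 0 < M := by linarith
  set z₀ : ℂ := M * gaussPt b with hz₀
  obtain ⟨F, hF⟩ := hf z₀
  have hz : ‖z₀ - M * gaussPt b‖ ≤ M / 2 := by simp [hz₀]; linarith
  obtain ⟨hT, -, -⟩ := D.regularPart_estimates (P := P) (b := b) hM le_rfl hz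
  have hangle := D.norm_sq_le_of_flat hf hM (hP hb) (hz.trans (by linarith)) hF
  have hv0 : inner ℂ (D.v b) (F z₀) ≠ 0 := by
    intro h0
    rw [h0, norm_zero] at hangle
    nlinarith [norm_pos_iff.2 hF.ne_zero]
  have hu0 : D.u b ≠ 0 := norm_ne_zero_iff.1 (by rw [D.norm_u]; norm_num)
  -- This is `(w - z₀)⁴ (1 + S) F` with its singularity removed. Its value at the pole is a multiple
  -- of `u b`, nonzero because flatness gives `⟨v b, F z₀⟩ ≠ 0`.
  set G : ℂ → EuclideanSpace ℂ (Fin (N + 1)) := fun w =>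
    (w - z₀) ^ 4 • (F w + D.regularPart P b w (F w)) +
      (100 ^ 4 * inner ℂ (D.v b) (F w)) • D.u b with hG
  have hvF : AnalyticAt ℂ (fun w => inner ℂ (D.v b) (F w)) z₀ :=
    ((innerSL ℂ (D.v b)).analyticAt _).comp hF.1
  have hGa : AnalyticAt ℂ G z₀ :=
    (((analyticAt_id.sub analyticAt_const).pow 4).smul
      (hF.1.add (analyticAt_clm_apply hT hF.1))).add
      ((analyticAt_const.mul hvF).smul analyticAt_const)
  have hG0 : G z₀ = (100 ^ 4 * inner ℂ (D.v b) (F z₀)) • D.u b := by simp [hG]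
  have hc0 : (100 ^ 4 * inner ℂ (D.v b) (F z₀) : ℂ) ≠ 0 := mul_ne_zero (by norm_num) hv0
  have hGne : G z₀ ≠ 0 := by rw [hG0]; exact smul_ne_zero hc0 hu0
  refine ⟨G, hGa, ?_⟩
  filter_upwards [D.gluing_eq_add hM hb hz, hF.eventually, hGa.continuousAt.eventually_ne hGne,
    Metric.ball_mem_nhds z₀ (by positivity : 0 < M / 2)] with w h1 h2 h3 h4
  rcases eq_or_ne w z₀ with rfl | hw
  · refine ⟨h3, ?_⟩
    have hex : ∃ n ∈ P, (M * gaussPt n : ℂ) = z₀ := ⟨b, hb, rfl⟩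
    have hch : hex.choose = b := by
      by_contra hne
      have := le_norm_mul_gaussPt_sub hM0.le hne
      rw [hex.choose_spec.2, ← hz₀, sub_self, norm_zero] at this
      linarith
    have e : D.gluedVector P z₀ = D.u b := by
      rw [gluedVector, dif_pos hex, hch]
    rw [glued, dif_pos (by rw [e]; exact hu0), Projectivization.mk_eq_mk_iff']
    exact ⟨_, by rw [e, hG0]⟩
  · have hw4 : (w - z₀) ^ 4 ≠ 0 := pow_ne_zero 4 (sub_ne_zero.2 hw)
    have hwn : ‖w - M * gaussPt b‖ ≤ M / 2 := (mem_ball_iff_norm.1 h4).le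
    have e : G w = (w - z₀) ^ 4 • (F w + D.gluing P w (F w)) := by
      rw [h1, hG]
      simp only [smul_add, smul_smul, div_pow]
      rw [← mul_assoc, mul_div_cancel₀ _ hw4]
      abel
    have hnp : ∀ n ∈ P, (M * gaussPt n : ℂ) ≠ w := fun n _ heq => by
      rcases eq_or_ne n b with rfl | hnb
      · exact hw heq.symm
      · have := far_from_other_poles hM0.le hwn hnb
        rw [heq, sub_self, norm_zero] at this
        linarith
    obtain ⟨h5, h6⟩ := h2.2.self_of_nhds
    have h7 : F w + D.gluing P w (F w) ≠ 0 := fun h0 => h3 (by rw [e, h0, smul_zero])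
    obtain ⟨h8, h9⟩ := D.exists_mk_eq_glued hnp h5 h6 hw4 h7
    exact ⟨h3, by rw [← h9]; congr 1⟩

end LatticeFrame

end Gluing

/-! ### Choice of parameters and conclusion. -/

theorem sphericalDeriv_le_of_derivSupNorm_lt_one {N : ℕ} {f : ℂ → CP N}
    (hf : derivSupNorm f Set.univ < 1) :
    ∃ s : ℝ, s < 1 ∧ ∀ z, sphericalDeriv f z ≤ s := by
  refine ⟨(derivSupNorm f Set.univ).toReal, ?_, fun z => ?_⟩
  · simpa using (ENNReal.toReal_lt_toReal hf.ne_top ENNReal.one_ne_top).2 hf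
  · refine (ENNReal.ofReal_le_iff_le_toReal hf.ne_top).1 ?_
    exact le_iSup₂ (f := fun z (_ : z ∈ Set.univ) => ENNReal.ofReal (sphericalDeriv f z)) z
      (Set.mem_univ z)

theorem derivSupNorm_lt_one {N : ℕ} {f : ℂ → CP N} {s : ℝ} (hs : s < 1)
    (hf : ∀ z, sphericalDeriv f z ≤ s) : derivSupNorm f Set.univ < 1 := by
  refine (iSup₂_le fun z _ => ENNReal.ofReal_le_ofReal (hf z)).trans_lt ?_
  simpa using hs

/-- The perturbation must be small relative to the flatness threshold `1/(1000M)`, whence the extra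
factor `M`; the fourth-order decay allows it. -/
theorem exists_large_spacing {K τ ε : ℝ} (hK : 0 ≤ K) (hτ : 0 < τ) (hε : 0 < ε) :
    ∃ M : ℝ, 400 ≤ M ∧ K * (100 / M) ^ 4 * M ≤ τ ∧ 1 / (1000 * M) ≤ ε := by
  refine ⟨400 + K * 100 ^ 4 / τ + 1 / ε, ?_, ?_, ?_⟩
  · have : 0 ≤ K * 100 ^ 4 / τ + 1 / ε := by positivity
    linarith
  · set M := 400 + K * 100 ^ 4 / τ + 1 / ε with hM
    have h1 : K * 100 ^ 4 / τ ≤ M := by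
      have : 0 ≤ 1 / ε := by positivity
      linarith
    have h2 : 1 ≤ M := by
      have : 0 ≤ K * 100 ^ 4 / τ + 1 / ε := by positivity
      linarith
    rw [div_le_iff₀ hτ] at h1
    have h3 : K * (100 / M) ^ 4 * M = K * 100 ^ 4 / M ^ 3 := by field_simp
    rw [h3, div_le_iff₀ (by positivity)]
    refine h1.trans ?_
    rw [mul_comm]
    gcongr
    exact le_self_pow₀ h2 (by norm_num)
  · rw [div_le_iff₀ (by positivity)]
    have h1 : ε * (1 / ε) = 1 := by field_simp
    have h2 : 0 ≤ ε * (K * 100 ^ 4 / τ) := by positivity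
    nlinarith

theorem far_or_near_or_pole (M : ℝ) (P : Set (ℤ × ℤ)) (z : ℂ) :
    (∀ n ∈ P, M / 2 ≤ ‖z - M * gaussPt n‖) ∨
      (∃ b ∈ P, z ≠ M * gaussPt b ∧ ‖z - M * gaussPt b‖ ≤ M / 2) ∨
      ∃ b ∈ P, z = M * gaussPt b := by
  by_cases h : ∀ n ∈ P, M / 2 ≤ ‖z - M * gaussPt n‖
  · exact .inl h
  · push Not at h
    obtain ⟨b, hb, hz⟩ := h
    by_cases hzb : z = M * gaussPt b
    · exact .inr (.inr ⟨b, hb, hzb⟩)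
    · exact .inr (.inl ⟨b, hb, hzb, hz.le⟩)

theorem exists_nondegenerate {N : ℕ} (hN : 1 ≤ N) {f : ℂ → CP N} (hf : IsHolomorphic f) {s : ℝ} (hs1 : s < 1) (hs : ∀ z, sphericalDeriv f z ≤ s) {ε : ℝ} (hε : 0 < ε) :
    ∃ g : ℂ → CP N, IsNondegenerateBrodyCurve g ∧ (∃ s' < 1, ∀ z, sphericalDeriv g z ≤ s') ∧
      ∀ z, sphericalDeriv f z ^ 2 ≤ sphericalDeriv g z ^ 2 + ε := by
  -- The three bounds yield `20η ≤ δ`, `s + 10η ≤ (1 + s)/2` and `2 · 10η ≤ ε`.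
  set τ : ℝ := min (1 / 20000) (min ((1 - s) / 20) (ε / 20)) with hτ
  have hτ0 : 0 < τ := lt_min (by norm_num) (lt_min (by linarith) (by linarith))
  have hτ1 : τ ≤ 1 / 20000 := min_le_left _ _
  have hτ2 : τ ≤ (1 - s) / 20 := (min_le_right _ _).trans (min_le_left _ _)
  have hτ3 : τ ≤ ε / 20 := (min_le_right _ _).trans (min_le_right _ _)
  obtain ⟨M, hM, hMτ, hMε⟩ := exists_large_spacing poleSumConst_nonneg hτ0 hε
  set η : ℝ := poleSumConst * (100 / M) ^ 4 with hη
  have hη0 : 0 ≤ η := mul_nonneg poleSumConst_nonneg (by positivity)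
  have hητ : η ≤ τ := by nlinarith
  have hM8 : 8 ≤ M := by linarith
  have hM0 : 0 < M := by linarith
  set δ : ℝ := 1 / (1000 * M) with hδ
  have hδ0 : 0 < δ := by positivity
  have hδ1 : δ ≤ 1 := by
    rw [hδ, div_le_one (by positivity)]; linarith
  have hδη : 20 * η ≤ δ := by
    rw [hδ, le_div_iff₀ (by positivity)]
    linarith
  obtain ⟨D⟩ := nonempty_latticeFrame hN f M
  set P := flatIndices f M δ with hP
  have hflat : ∀ {b z}, b ∈ P → ‖z - M * gaussPt b‖ ≤ M → sphericalDeriv f z ≤ δ :=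
    fun hb hz => hb _ (mem_closedBall_iff_norm.2 hz)
  have hfar : ∀ {z}, (∀ n ∈ P, M / 2 ≤ ‖z - M * gaussPt n‖) → (∃ G, IsLocalLift (D.glued P) z G) ∧
      |sphericalDeriv (D.glued P) z - sphericalDeriv f z| ≤ 10 * η := fun {z} hz => by
    obtain ⟨F, hF⟩ := hf z
    obtain ⟨h1, h2⟩ := D.far_estimates hM8 le_rfl (by linarith) hz hF ((hs z).trans hs1.le)
    exact ⟨⟨_, h1⟩, h2⟩
  have hnear : ∀ {z b}, b ∈ P → z ≠ M * gaussPt b → ‖z - M * gaussPt b‖ ≤ M / 2 →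
      (∃ G, IsLocalLift (D.glued P) z G) ∧ sphericalDeriv (D.glued P) z ≤ 1 / 10 ∧
      (‖z - M * gaussPt b‖ = 100 → 1 / 400 ≤ sphericalDeriv (D.glued P) z) :=
    fun {z b} hb hz0 hz => by
      obtain ⟨F, hF⟩ := hf z
      obtain ⟨h1, h2⟩ := D.near_estimates hf hM8 le_rfl (by linarith) hb subset_rfl hz0 hz hF
      exact ⟨⟨_, h1⟩, h2⟩
  have hhol : IsHolomorphic (D.glued P) := fun z => by
    rcases far_or_near_or_pole M P z with h | ⟨b, hb, h0, h⟩ | ⟨b, hb, rfl⟩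
    · exact (hfar h).1
    · exact (hnear hb h0 h).1
    · exact D.exists_isLocalLift_glued_pole hf hM8 hb subset_rfl
  have hcont := hhol.continuous_sphericalDeriv
  -- The bound on the punctured disk extends to the pole by continuity.
  have hpole : ∀ b ∈ P, sphericalDeriv (D.glued P) (M * gaussPt b) ≤ 1 / 10 := fun b hb => by
    refine le_of_tendsto (x := 𝓝[≠] (M * gaussPt b : ℂ))
      (hcont.continuousAt.tendsto.mono_left nhdsWithin_le_nhds) ?_
    filter_upwards [self_mem_nhdsWithin, nhdsWithin_le_nhds
      (Metric.closedBall_mem_nhds (M * gaussPt b : ℂ) (by positivity : 0 < M / 2))] with w h1 h2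
    exact (hnear hb h1 (mem_closedBall_iff_norm.1 h2)).2.1
  have hbound : ∀ z, sphericalDeriv (D.glued P) z ≤ max ((1 + s) / 2) (1 / 10) := fun z => by
    rcases far_or_near_or_pole M P z with h | ⟨b, hb, h0, h⟩ | ⟨b, hb, rfl⟩
    · refine le_max_of_le_left ?_
      linarith [(abs_le.1 (hfar h).2).2, hs z]
    · exact le_max_of_le_right (hnear hb h0 h).2.1
    · exact le_max_of_le_right (hpole b hb)
  have hs'1 : max ((1 + s) / 2) (1 / 10) < 1 := max_lt (by linarith) (by norm_num)
  have hlower : ∀ {a p : ℂ}, ‖p - a‖ ≤ 2 * M →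
      min (1 / 400) (δ / 2) ≤ sphericalDeriv (D.glued P) p →
      ENNReal.ofReal (min (1 / 400) (δ / 2)) ≤
        derivSupNorm (D.glued P) (Metric.closedBall a (2 * M)) := fun {a p} hp h =>
    (ENNReal.ofReal_le_ofReal h).trans
      (le_iSup₂ (f := fun z (_ : z ∈ Metric.closedBall a (2 * M)) =>
        ENNReal.ofReal (sphericalDeriv (D.glued P) z)) p (mem_closedBall_iff_norm.2 hp))
  refine ⟨D.glued P, ⟨⟨hhol, fun z => (hbound z).trans hs'1.le⟩, min (1 / 400) (δ / 2),
    lt_min (by norm_num) (by linarith), 2 * M, by linarith, fun a => ?_⟩,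
    ⟨_, hs'1, hbound⟩, fun z => ?_⟩
  · obtain ⟨n, hn⟩ := exists_near_gaussPt hM0 a
    rw [norm_sub_rev] at hn
    have htri : ∀ {p : ℂ} {t : ℝ}, ‖p - M * gaussPt n‖ ≤ t → ‖p - a‖ ≤ t + 3 / 4 * M :=
      fun {p t} h => by
        have := norm_add_le (p - M * gaussPt n) (M * gaussPt n - a)
        rw [sub_add_sub_cancel] at this
        linarith
    -- If the nearby lattice point carries a bubble, its circle of radius 100 gives `1/400`.
    -- Otherwise some `p` in its disk has `|df| > δ`. Such a `p` lies in no flat disk, so the far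
    -- estimate applies and leaves at least `δ - 10η ≥ δ/2`.
    by_cases hnP : n ∈ P
    · have h100 : ‖(M * gaussPt n + 100 : ℂ) - M * gaussPt n‖ = 100 := by simp
      refine hlower ((htri h100.le).trans (by linarith)) ((min_le_left _ _).trans ?_)
      exact (hnear hnP (by simp) (h100.le.trans (by linarith))).2.2 h100
    · simp only [hP, flatIndices, Set.mem_ofPred_eq, not_forall, not_le] at hnP
      obtain ⟨p, hpn, hpδ⟩ := hnP
      refine hlower ((htri (mem_closedBall_iff_norm.1 hpn)).trans (by linarith))
        ((min_le_right _ _).trans ?_)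
      have hpfar : ∀ m ∈ P, M / 2 ≤ ‖p - M * gaussPt m‖ := fun m hm => by
        by_contra! hlt
        exact absurd (hflat hm (hlt.le.trans (by linarith))) (not_le.2 hpδ)
      linarith [(abs_le.1 (hfar hpfar).2).1]
  -- Near a pole nothing about `g` is needed: `|df|² ≤ δ² ≤ δ ≤ ε`.
  · have hflatε : ∀ {b}, b ∈ P → ‖z - M * gaussPt b‖ ≤ M →
        sphericalDeriv f z ^ 2 ≤ sphericalDeriv (D.glued P) z ^ 2 + ε := fun hb hz => by
      have h1 := hflat hb hz
      have h2 := sphericalDeriv_nonneg f z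
      nlinarith [sq_nonneg (sphericalDeriv (D.glued P) z)]
    rcases far_or_near_or_pole M P z with h | ⟨b, hb, h0, h⟩ | ⟨b, hb, hzb⟩
    · have h1 := (abs_le.1 (hfar h).2).1
      have h2 := (hbound z).trans hs'1.le
      have h3 := (hs z).trans hs1.le
      have h4 := sphericalDeriv_nonneg f z
      have h5 := sphericalDeriv_nonneg (D.glued P) z
      nlinarith
    · exact hflatε hb (h.trans (by linarith))
    · exact hflatε hb (by simp [hzb, hM0.le])

end BrodyCurves

theorem mainTheorem4 (N : ℕ) (hN : 1 ≤ N) (f : ℂ → BrodyCurves.CP N)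
    (hf : BrodyCurves.IsHolomorphic f) (hf1 : BrodyCurves.derivSupNorm f Set.univ < 1)
    (ε : ℝ) (hε : 0 < ε) :
    Tendsto (BrodyCurves.meanEnergy f) atTop (𝓝 (BrodyCurves.energyDensity f)) ∧
    ∃ g : ℂ → BrodyCurves.CP N,
      BrodyCurves.IsNondegenerateBrodyCurve g ∧
      BrodyCurves.derivSupNorm g Set.univ < 1 ∧
      Tendsto (BrodyCurves.meanEnergy g) atTop (𝓝 (BrodyCurves.energyDensity g)) ∧
      BrodyCurves.energyDensity g ≥ BrodyCurves.energyDensity f - ε := by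
  obtain ⟨s, hs1, hs⟩ := BrodyCurves.sphericalDeriv_le_of_derivSupNorm_lt_one hf1
  have hfB : BrodyCurves.IsBrodyCurve f := ⟨hf, fun z => (hs z).trans hs1.le⟩
  obtain ⟨g, hg, ⟨s', hs'1, hs'⟩, hge⟩ := BrodyCurves.exists_nondegenerate hN hf hs1 hs hε
  exact ⟨hfB.tendsto_meanEnergy, g, hg, BrodyCurves.derivSupNorm_lt_one hs'1 hs',
    hg.1.tendsto_meanEnergy, BrodyCurves.energyDensity_ge_of_sq_le hfB hg.1 hge⟩
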